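/- **Setting.** Let $n_x,n_u,n_g,n_h,n_P,n_Q\in\mathbb N$, $t_{\mathrm i}\ge 0$, and let $L(t,x)\in\mathbb R$, $f(t,x,u)\in\mathbb R^{n_x}$, $g(t,x,u)\in\mathbb R^{n_g}$, $h(t,x,u)\in\mathbb R^{n_h}$, $P(t,x,t',x')\in\mathbb R^{n_P}$, $Q(t,x,t',x')\in\mathbb R^{n_Q}$ be continuously differentiable functions of $t,t'\in\mathbb R$, $x,x'\in\mathbb R^{n_x}$, $u\in\mathbb R^{n_u}$. Assume that for every compact $\mathbb U\subset\mathbb R^{n_u}$ and every $t_{\mathrm f}>t_{\mathrm i}$ there are $\vartheta,\varrho>0$ with $\|f(t,x,u)\|\le\vartheta\|x\|+\varrho$ for all $t\in[t_{\mathrm i},t_{\mathrm f}]$, $x\in\mathbb R^{n_x}$, $u\in\mathbb U$. Let $q_i,p_j:\mathbb R\to[0,\infty)$ ($i\le n_g$, $j\le n_h$) be continuously differentiable with $q_i(w)=0$ iff $w\le 0$ and $p_j(w)=0$ iff $w=0$, and put $\Lambda(t,x,u)=\sum_i q_i(g_i(t,x,u))+\sum_j p_j(h_j(t,x,u))$.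 For an augmented state $\tilde x=(x,y,t)\in\mathbb R^{n_x+2}$ and an augmented input $(u,s)\in\mathbb R^{n_u+1}$ put $F(\tilde x,(u,s))=s\,(f(t,x,u),\Lambda(t,x,u),1)$. Let $0=\tau_1<\dots<\tau_N=1$, let $\Gamma_u^1,\dots,\Gamma_u^{N_u},\Gamma_s^1,\dots,\Gamma_s^{N_s}$ be piecewise polynomials on $[0,1]$, and for $U=(u_1,\dots,u_{N_u})\in\mathbb R^{n_uN_u}$ and $S\in\mathbb R^{N_s}$ put $\tilde\nu(\tau)=\big(\sum_k\Gamma_u^k(\tau)u_k,\ \sum_k\Gamma_s^k(\tau)S_k\big)$. For $k=1,\dots,N-1$ let $$F_k(\tilde x_{k+1},\tilde x_k,U,S)=\tilde x_{k+1}-\tilde x_k-\int_{\tau_k}^{\tau_{k+1}}F(\tilde x^k(\tau),\tilde\nu(\tau))\,\mathrm d\tau,$$ where $\tilde x^k$ is the absolutely continuous solution on $[\tau_k,\tau_{k+1}]$ of $\frac{\mathrm d}{\mathrm d\tau}\tilde x^k=F(\tilde x^k,\tilde\nu)$ a.e., $\tilde x^k(\tau_k)=\tilde x_k$. Let $\epsilon>0$,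 and let $\mathcal U\subset\mathbb R^{n_uN_u}$ and $\mathcal S\subset\mathbb R^{N_s}$ be compact sets, each described by finitely many inequalities $\Omega\le 0$ with continuously differentiable convex $\Omega$ and finitely many affine equations, such that $\sum_k\Gamma_s^k(\tau)S_k>0$ for almost every $\tau\in[0,1]$ whenever $S\in\mathcal S$. Consider, in the variable $z=(\tilde x_1,\dots,\tilde x_N,U,S)\in\mathbb R^{n_z}$, the discretized problem: minimize $\tilde L(\tilde x_N)$ subject to $F_k(\tilde x_{k+1},\tilde x_k,U,S)=0$ and $y_{k+1}-y_k\le\epsilon$ for $k=1,\dots,N-1$, $U\in\mathcal U$, $S\in\mathcal S$, $\tilde P(\tilde x_1,\tilde x_N)\le 0$ and $\tilde Q(\tilde x_1,\tilde x_N)=0$, where, with $\tilde x_k=(x_k,y_k,t_k)$, $\tilde L(\tilde x_N)=L(t_N,x_N)$, $\tilde P(\tilde x_1,\tilde x_N)=P(t_1,x_1,t_N,x_N)$ and $\tilde Q(\tilde x_1,\tilde x_N)=(Q(t_{\mathrm i},x_1,t_N,x_N),\,t_1-t_{\mathrm i})$. Let $\mathcal Z$ be the set of all $z$ with $y_{k+1}-y_k\le\epsilon$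 for $k=1,\dots,N-1$, $U\in\mathcal U$ and $S\in\mathcal S$, and for $\gamma>0$ let $$\Theta_\gamma(z)=\tilde L(\tilde x_N)+\tilde I_{\mathcal Z}(z)+\gamma\sum_i\max\{0,\tilde P_i\}+\gamma\|\tilde Q\|_1+\gamma\sum_{k=1}^{N-1}\|F_k\|_1\in(-\infty,+\infty],$$ where $\tilde I_{\mathcal Z}$ is $0$ on $\mathcal Z$ and $+\infty$ off $\mathcal Z$. A point $z$ is a stationary point of $\Theta_\gamma$ if $\Theta_\gamma(z)<\infty$ and $0\in\partial\Theta_\gamma(z)$ for the limiting subdifferential. LICQ holds at $z$ if the gradients at $z$ of all scalar equality constraints and of all active scalar inequality constraints (including those describing $\mathcal U$ and $\mathcal S$) are linearly independent. **Theorem.** Let $z^\star$ be a local minimizer (strict or not) of the discretized problem at which LICQ holds. Then there is $\bar\gamma>0$ such that $z^\star$ is a local minimizer of $\Theta_\gamma$ for every $\gamma\ge\bar\gamma$. Moreover, there are $\tilde\gamma>0$ and $\tilde\sigma>0$ such that, for every $\gamma\ge\tilde\gamma$, every stationary point $z$ of $\Theta_\gamma$ with $\|z-z^\star\|\le\tilde\sigma$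 is feasible for the discretized problem. -/

import Mathlib

open Set Filter Topology MeasureTheory

noncomputable section

namespace CTOpt

/-- The Euclidean space `ℝⁿ`. -/
abbrev Vec (n : ℕ) : Type := EuclideanSpace ℝ (Fin n)

/-! ### The optimal control problem -/

/-- Data of the free-final-time optimal control problem: minimize `L(t_f, x(t_f))` subject to
`ẋ = f(t, x, u)`, `g(t, x, u) ≤ 0`, `h(t, x, u) = 0`, `P(t_i, x(t_i), t_f, x(t_f)) ≤ 0` and
`Q(t_i, x(t_i), t_f, x(t_f)) = 0`, with continuously differentiable data. -/
structure OptimalControlProblem (nx nu : ℕ) where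
  /-- number of inequality path constraints -/
  ng : ℕ
  /-- number of equality path constraints -/
  nh : ℕ
  /-- number of inequality boundary conditions -/
  nP : ℕ
  /-- number of equality boundary conditions -/
  nQ : ℕ
  /-- the fixed initial time -/
  ti : ℝ
  ti_nonneg : 0 ≤ ti
  L : ℝ × Vec nx → ℝ
  f : ℝ × Vec nx × Vec nu → Vec nx
  g : ℝ × Vec nx × Vec nu → Vec ng
  h : ℝ × Vec nx × Vec nu → Vec nh
  P : ℝ × Vec nx × ℝ × Vec nx → Vec nP
  Q : ℝ × Vec nx × ℝ × Vec nx → Vec nQ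
  contDiff_L : ContDiff ℝ 1 L
  contDiff_f : ContDiff ℝ 1 f
  contDiff_g : ContDiff ℝ 1 g
  contDiff_h : ContDiff ℝ 1 h
  contDiff_P : ContDiff ℝ 1 P
  contDiff_Q : ContDiff ℝ 1 Q
  /-- linear growth of the dynamics in the state, uniformly over bounded times after the initial
  time and over compact sets of control values -/
  growth : ∀ K : Set (Vec nu), IsCompact K → ∀ tf : ℝ, ti < tf →
    ∃ a b : ℝ, 0 < a ∧ 0 < b ∧
      ∀ t ∈ Icc ti tf, ∀ x : Vec nx, ∀ u ∈ K, ‖f (t, x, u)‖ ≤ a * ‖x‖ + b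

/-! ### Ingredients of the discretization -/

/-- Continuously differentiable exterior penalty function for the constraint `w ≤ 0`. -/
def IsIneqPenalty (q : ℝ → ℝ) : Prop :=
  ContDiff ℝ 1 q ∧ (∀ w, w ≤ 0 → q w = 0) ∧ (∀ w, 0 < w → 0 < q w)

/-- Continuously differentiable exterior penalty function for the constraint `w = 0`. -/
def IsEqPenalty (p : ℝ → ℝ) : Prop :=
  ContDiff ℝ 1 p ∧ p 0 = 0 ∧ (∀ w, w ≠ 0 → 0 < p w)

/-- `φ` is a piecewise polynomial on `[0, 1]` (with arbitrary values at the finitely many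
breakpoints). -/
def IsPiecewisePolynomial (φ : ℝ → ℝ) : Prop :=
  ∃ (m : ℕ) (b : Fin (m + 1) → ℝ), StrictMono b ∧ b 0 = 0 ∧ b (Fin.last m) = 1 ∧
    ∀ i : Fin m, ∃ p : Polynomial ℝ, ∀ τ ∈ Ioo (b i.castSucc) (b i.succ), φ τ = p.eval τ

/-- A convex set described by finitely many continuously differentiable convex inequalities
`Ω i z ≤ 0` and finitely many affine equalities `a jᵀ z + b j = 0`. -/
structure ConvexSystem (E : Type) [NormedAddCommGroup E] [InnerProductSpace ℝ E] where
  /-- number of inequalities -/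
  nIneq : ℕ
  /-- number of affine equalities -/
  nEq : ℕ
  Ω : Fin nIneq → E → ℝ
  a : Fin nEq → E
  b : Fin nEq → ℝ
  contDiff_Ω : ∀ i, ContDiff ℝ 1 (Ω i)
  convex_Ω : ∀ i, ConvexOn ℝ univ (Ω i)

namespace ConvexSystem

variable {E : Type} [NormedAddCommGroup E] [InnerProductSpace ℝ E]

/-- The left-hand side of the `j`-th affine equality. -/
def aff (C : ConvexSystem E) (j : Fin C.nEq) (z : E) : ℝ := inner ℝ (C.a j) z + C.b j

/-- The set described by the system. -/
def set (C : ConvexSystem E) : Set E :=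
  {z | (∀ i, C.Ω i z ≤ 0) ∧ ∀ j, C.aff j z = 0}

end ConvexSystem

/-- Coefficients `U = (u₁, …, u_{Nu})`, with blocks in `ℝ^{nu}`, of the control input. -/
abbrev CtrlCoeff (nu Nu : ℕ) : Type := EuclideanSpace ℝ (Fin Nu × Fin nu)

/-- Everything that has to be chosen in order to discretize an optimal control problem. -/
structure Discretization {nx nu : ℕ} (O : OptimalControlProblem nx nu) where
  /-- exterior penalties for the inequality path constraints -/
  q : Fin O.ng → ℝ → ℝ
  /-- exterior penalties for the equality path constraints -/
  p : Fin O.nh → ℝ → ℝ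
  penalty_q : ∀ i, IsIneqPenalty (q i)
  penalty_p : ∀ j, IsEqPenalty (p j)
  /-- number of shooting intervals, i.e. the number of nodes minus one -/
  M : ℕ
  /-- the nodes `0 = τ₁ < ⋯ < τ_N = 1`, with `N = M + 1` -/
  node : Fin (M + 1) → ℝ
  node_strictMono : StrictMono node
  node_zero : node 0 = 0
  node_last : node (Fin.last M) = 1
  /-- number of basis functions for the control input -/
  Nu : ℕ
  /-- number of basis functions for the dilation factor -/
  Ns : ℕ
  Γu : Fin Nu → ℝ → ℝ
  Γs : Fin Ns → ℝ → ℝ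
  piecewise_Γu : ∀ k, IsPiecewisePolynomial (Γu k)
  piecewise_Γs : ∀ k, IsPiecewisePolynomial (Γs k)
  /-- description of the compact convex set for the control coefficients -/
  US : ConvexSystem (CtrlCoeff nu Nu)
  /-- description of the compact convex set for the dilation coefficients -/
  SS : ConvexSystem (Vec Ns)
  compact_US : IsCompact US.set
  compact_SS : IsCompact SS.set
  /-- admissible dilation factors are positive -/
  dilation_pos : ∀ S ∈ SS.set, ∀ᵐ τ ∂(volume.restrict (Icc (0 : ℝ) 1)), 0 < ∑ k, Γs k τ * S k
  /-- relaxation constant -/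
  ε : ℝ
  ε_pos : 0 < ε

/-! ### The augmented system -/

section Augmented

variable {nx : ℕ}

/-- The first `nx` entries of an augmented state `(x, y, t)`. -/
def selX (w : Vec (nx + 2)) : Vec nx := WithLp.toLp 2 fun i => w (Fin.castAdd 2 i)

/-- The penultimate entry of an augmented state `(x, y, t)`. -/
def selY (w : Vec (nx + 2)) : ℝ := w (Fin.natAdd nx (0 : Fin 2))

/-- The last entry of an augmented state `(x, y, t)`. -/
def selT (w : Vec (nx + 2)) : ℝ := w (Fin.natAdd nx (1 : Fin 2))

/-- The augmented state `(x, y, t)`. -/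
def mkAug (x : Vec nx) (y t : ℝ) : Vec (nx + 2) :=
  WithLp.toLp 2 (Fin.append (fun i => x i) ![y, t])

end Augmented

namespace Discretization

variable {nx nu : ℕ} {O : OptimalControlProblem nx nu} (D : Discretization O)

/-- Total penalty of the violation of the path constraints. -/
def Λ (v : ℝ × Vec nx × Vec nu) : ℝ :=
  ∑ i, D.q i (O.g v i) + ∑ j, D.p j (O.h v j)

/-- Right-hand side of the augmented system at augmented state `w` and augmented control input
`(u, s)`. -/
def F (w : Vec (nx + 2)) (c : Vec nu × ℝ) : Vec (nx + 2) :=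
  c.2 • mkAug (O.f (selT w, selX w, c.1)) (D.Λ (selT w, selX w, c.1)) 1

/-- The parameterized augmented control input `(∑ₖ Γuᵏ(τ) uₖ, ∑ₖ Γsᵏ(τ) Sₖ)`. -/
def ν (U : CtrlCoeff nu D.Nu) (S : Vec D.Ns) (τ : ℝ) : Vec nu × ℝ :=
  (WithLp.toLp 2 fun i => ∑ k, D.Γu k τ * U (k, i), ∑ k, D.Γs k τ * S k)

/-- `φ` is an augmented state trajectory on `[a, b]` with initial condition `w` (the integral form
of "absolutely continuous and solves the differential equation almost everywhere"). -/
def IsTrajectory (U : CtrlCoeff nu D.Nu) (S : Vec D.Ns) (a b : ℝ) (w : Vec (nx + 2))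
    (φ : ℝ → Vec (nx + 2)) : Prop :=
  ContinuousOn φ (Icc a b) ∧
  IntervalIntegrable (fun τ => D.F (φ τ) (D.ν U S τ)) volume a b ∧
  ∀ τ ∈ Icc a b, φ τ = w + ∫ σ in a..τ, D.F (φ σ) (D.ν U S σ)

open Classical in
/-- The augmented state trajectory on `[a, b]` with initial condition `w`; it is unique on `[a, b]`.
Where there is none (which cannot happen at or near a feasible point), the value is irrelevant. -/
def trajectory (U : CtrlCoeff nu D.Nu) (S : Vec D.Ns) (a b : ℝ) (w : Vec (nx + 2)) :
    ℝ → Vec (nx + 2) :=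
  if hφ : ∃ φ, D.IsTrajectory U S a b w φ then hφ.choose else fun _ => w

/-- The multiple-shooting defect
`Fₖ(x̃ₖ₊₁, x̃ₖ, U, S) = x̃ₖ₊₁ - x̃ₖ - ∫ F(x̃ᵏ(τ), ν̃(τ)) dτ` over `[τₖ, τₖ₊₁]`. -/
def defect (k : Fin D.M) (w' w : Vec (nx + 2)) (U : CtrlCoeff nu D.Nu) (S : Vec D.Ns) :
    Vec (nx + 2) :=
  w' - w - ∫ τ in (D.node k.castSucc)..(D.node k.succ),
    D.F (D.trajectory U S (D.node k.castSucc) (D.node k.succ) w τ) (D.ν U S τ)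

/-! ### The discretized problem -/

/-- Index set of the coordinates of a decision vector `z = (x̃₁, …, x̃_N, U, S)`. -/
abbrev Idx : Type := (Fin (D.M + 1) × Fin (nx + 2)) ⊕ ((Fin D.Nu × Fin nu) ⊕ Fin D.Ns)

/-- The space `ℝ^{n_z}` of decision vectors `z = (x̃₁, …, x̃_N, U, S)`, with the Euclidean norm. -/
abbrev Z : Type := EuclideanSpace ℝ D.Idx

variable {D}

/-- The augmented state at a node. -/
def xt (z : D.Z) (k : Fin (D.M + 1)) : Vec (nx + 2) := WithLp.toLp 2 fun i => z (Sum.inl (k, i))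

/-- The control coefficients. -/
def ctrl (z : D.Z) : CtrlCoeff nu D.Nu := WithLp.toLp 2 fun i => z (Sum.inr (Sum.inl i))

/-- The dilation coefficients. -/
def dil (z : D.Z) : Vec D.Ns := WithLp.toLp 2 fun i => z (Sum.inr (Sum.inr i))

variable (D)

/-- The objective `L̃(x̃_N)`. -/
def obj (z : D.Z) : ℝ := O.L (selT (xt z (Fin.last D.M)), selX (xt z (Fin.last D.M)))

/-- The `i`-th entry of `P̃(x̃₁, x̃_N)`. -/
def Pt (i : Fin O.nP) (z : D.Z) : ℝ :=
  O.P (selT (xt z 0), selX (xt z 0), selT (xt z (Fin.last D.M)), selX (xt z (Fin.last D.M))) i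

/-- The `i`-th entry of `Q̃(t_i, x̃₁, x̃_N)`; the last entry is `t₁ - t_i`. -/
def Qt (i : Fin (O.nQ + 1)) (z : D.Z) : ℝ :=
  Fin.snoc (α := fun _ => ℝ)
    (fun j => O.Q (O.ti, selX (xt z 0), selT (xt z (Fin.last D.M)), selX (xt z (Fin.last D.M))) j)
    (selT (xt z 0) - O.ti) i

/-- The `i`-th entry of `Fₖ(x̃ₖ₊₁, x̃ₖ, U, S)`. -/
def Fk (k : Fin D.M) (i : Fin (nx + 2)) (z : D.Z) : ℝ :=
  D.defect k (xt z k.succ) (xt z k.castSucc) (ctrl z) (dil z) i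

/-- The left-hand side of the relaxed constraint `y_{k+1} - y_k - ε ≤ 0`. -/
def relax (k : Fin D.M) (z : D.Z) : ℝ :=
  selY (xt z k.succ - xt z k.castSucc) - D.ε

/-- The closed convex set described by the relaxed constraints and the constraints on the
coefficients. -/
def Zset : Set D.Z :=
  {z | (∀ k, D.relax k z ≤ 0) ∧ ctrl z ∈ D.US.set ∧ dil z ∈ D.SS.set}

/-- The feasible set of the discretized problem. -/
def feasible : Set D.Z :=
  {z | (∀ k i, D.Fk k i z = 0) ∧ z ∈ D.Zset ∧ (∀ i, D.Pt i z ≤ 0) ∧ ∀ i, D.Qt i z = 0}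

/-- `z` is a (not necessarily strict) local minimizer of the discretized problem. -/
def IsLocalMinimizer (z : D.Z) : Prop :=
  z ∈ D.feasible ∧ IsLocalMinOn D.obj D.feasible z

/-! ### Linear independence constraint qualification -/

/-- Index set of all the scalar equality constraints. -/
abbrev EqIdx : Type :=
  (Fin D.M × Fin (nx + 2)) ⊕ Fin (O.nQ + 1) ⊕ Fin D.US.nEq ⊕ Fin D.SS.nEq

/-- Index set of all the scalar inequality constraints. -/
abbrev IneqIdx : Type := Fin O.nP ⊕ Fin D.M ⊕ Fin D.US.nIneq ⊕ Fin D.SS.nIneq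

/-- The scalar equality constraints `eqC i z = 0`. -/
def eqC : D.EqIdx → D.Z → ℝ
  | .inl ki, z => D.Fk ki.1 ki.2 z
  | .inr (.inl i), z => D.Qt i z
  | .inr (.inr (.inl j)), z => D.US.aff j (ctrl z)
  | .inr (.inr (.inr j)), z => D.SS.aff j (dil z)

/-- The scalar inequality constraints `ineqC i z ≤ 0`. -/
def ineqC : D.IneqIdx → D.Z → ℝ
  | .inl i, z => D.Pt i z
  | .inr (.inl k), z => D.relax k z
  | .inr (.inr (.inl i)), z => D.US.Ω i (ctrl z)
  | .inr (.inr (.inr i)), z => D.SS.Ω i (dil z)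

/-- LICQ at `z`: the gradients at `z` of all the equality constraints and of the inequality
constraints that are active at `z` are linearly independent. -/
def LICQ (z : D.Z) : Prop :=
  LinearIndependent ℝ
    (Sum.elim (fun i : D.EqIdx => fderiv ℝ (D.eqC i) z)
      (fun i : {i : D.IneqIdx // D.ineqC i z = 0} => fderiv ℝ (D.ineqC i.1) z))

end Discretization

/-! ### Nonsmooth analysis -/

section Subdifferential

variable {E : Type} [NormedAddCommGroup E] [NormedSpace ℝ E]

open Classical in
/-- The indicator function of a set, with values `0` and `+∞`. -/
def indicatorFun (C : Set E) (z : E) : EReal := if z ∈ C then 0 else ⊤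

/-- The Fréchet subdifferential: `φ(z') ≥ φ(z) + v(z' - z) - o(‖z' - z‖)`, where `φ(z)` is
finite. -/
def frechetSubdifferential (φ : E → EReal) (z : E) : Set (E →L[ℝ] ℝ) :=
  {v | φ z ≠ ⊤ ∧ φ z ≠ ⊥ ∧ ∀ η : ℝ, 0 < η → ∀ᶠ z' in 𝓝 z,
    φ z + ((v (z' - z) - η * ‖z' - z‖ : ℝ) : EReal) ≤ φ z'}

/-- The (limiting) subdifferential of an extended-real-valued function. -/
def subdifferential (φ : E → EReal) (z : E) : Set (E →L[ℝ] ℝ) :=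
  {v | φ z ≠ ⊤ ∧ φ z ≠ ⊥ ∧ ∃ (zs : ℕ → E) (vs : ℕ → E →L[ℝ] ℝ),
    Tendsto zs atTop (𝓝 z) ∧ Tendsto (fun n => φ (zs n)) atTop (𝓝 (φ z)) ∧
    (∀ n, vs n ∈ frechetSubdifferential φ (zs n)) ∧ Tendsto vs atTop (𝓝 v)}

/-- Stationary points: `0 ∈ ∂φ(z)`. -/
def IsStationary (φ : E → EReal) (z : E) : Prop := 0 ∈ subdifferential φ z

end Subdifferential

/-! ### The penalized problem -/

namespace Discretization

variable {nx nu : ℕ} {O : OptimalControlProblem nx nu} (D : Discretization O)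

/-- The `ℓ₁` penalty of the nonconvex constraints. -/
def penalty (z : D.Z) : ℝ :=
  ∑ i, max 0 (D.Pt i z) + ∑ i, |D.Qt i z| + ∑ k, ∑ i, |D.Fk k i z|

/-- The function `Θ_γ`. -/
def Θ (γ : ℝ) (z : D.Z) : EReal :=
  ((D.obj z + γ * D.penalty z : ℝ) : EReal) + indicatorFun D.Zset z

end Discretization

end CTOpt

end

/-!
The proof rests on strict differentiability of all constraints at the single point `zstar`, which is
also all that the linear independence hypothesis refers to.

*Exact penalization.* The map formed by all equality constraints and all inequality constraints
active at `zstar` has a surjective strict derivative there, hence near `zstar` its values can be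
prescribed by moving a distance proportional to the change
(`exists_steering_of_linearIndependent`). Scaling the violations of the penalized constraints by
`1 - t` while keeping the values of the others gives a step that stays in `Zset`, has length at most
`κ t` times the penalty, and reduces the penalty by the fraction `t` (`exists_penalty_descent`).
With `t = 1` the step ends in the feasible set, and the Lipschitz continuity of the objective yields
local minimality of the penalty function. With `t → 0` it shows that, wherever the penalty is
positive, the penalty function decreases with slope at least `γ / κ` minus the Lipschitz constant of
the objective. This keeps Fréchet subgradients away from zero at points of positive penalty, and so
limiting subgradients as well, because convergence of the function values forces convergence of the
penalties. Neither a sum rule nor any normal cone enters.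

*Strict differentiability of the defects.* The control input is only bounded and measurable in time,
so the augmented system is treated as an integral equation in `C([a, b])`. Integral operators of
Volterra type have an iterate that is a contraction (`existsUnique_fixedPoint_of_volterra`); this
gives uniqueness of trajectories, existence under an a priori bound, and invertibility of the
linearized equation. The implicit function theorem then makes the endpoint of the trajectory a
strictly differentiable function of the decision vector near any point where the trajectory exists
(`exists_hasStrictFDerivAt_endpoint`). At a feasible point it exists on every shooting interval:
since dilation factors are positive, time stays above the initial time, so the linear growth of `f`
applies and Grönwall's inequality bounds the state (`exists_bound_of_damped`,
`exists_isSol_of_feasible`).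
-/

noncomputable section

namespace CTOpt

/-! ### Exact penalization under linear independence -/

section SoftPenalty

variable {E I J : Type}

/-- The `ℓ₁` penalty of the equality constraints `c i z = 0` with `sE i` and of the inequality
constraints `g j z ≤ 0` with `sI j`. -/
def softPenalty [Fintype I] [Fintype J] (c : I → E → ℝ) (g : J → E → ℝ)
    (sE : I → Prop) (sI : J → Prop) [DecidablePred sE] [DecidablePred sI] (z : E) : ℝ :=
  ∑ i, (if sE i then |c i z| else 0) + ∑ j, (if sI j then max 0 (g j z) else 0)

/-- The set described by the constraints that are not penalized. -/
def hardSet (c : I → E → ℝ) (g : J → E → ℝ) (sE : I → Prop) (sI : J → Prop) : Set E :=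
  {z | (∀ i, ¬ sE i → c i z = 0) ∧ ∀ j, ¬ sI j → g j z ≤ 0}

variable [Fintype I] [Fintype J] {c : I → E → ℝ} {g : J → E → ℝ}
  {sE : I → Prop} {sI : J → Prop} [DecidablePred sE] [DecidablePred sI]

theorem softPenalty_nonneg (z : E) : 0 ≤ softPenalty c g sE sI z := by
  refine add_nonneg (Finset.sum_nonneg fun i _ => ?_) (Finset.sum_nonneg fun j _ => ?_) <;>
    split_ifs <;> simp

theorem eq_term_le_softPenalty (z : E) (i : I) :
    |if sE i then c i z else 0| ≤ softPenalty c g sE sI z := by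
  have h1 : |if sE i then c i z else 0| = if sE i then |c i z| else 0 := by
    split_ifs <;> simp
  rw [h1]
  refine (Finset.single_le_sum (f := fun i => if sE i then |c i z| else 0) (fun i _ => ?_)
    (Finset.mem_univ i)).trans (le_add_of_nonneg_right (Finset.sum_nonneg fun j _ => ?_)) <;>
    split_ifs <;> simp

theorem ineq_term_le_softPenalty (z : E) (j : J) :
    |if sI j then max 0 (g j z) else 0| ≤ softPenalty c g sE sI z := by
  have h1 : |if sI j then max 0 (g j z) else 0| = if sI j then max 0 (g j z) else 0 := by
    split_ifs <;> simp
  rw [h1]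
  refine (Finset.single_le_sum (f := fun j => if sI j then max 0 (g j z) else 0) (fun j _ => ?_)
    (Finset.mem_univ j)).trans (le_add_of_nonneg_left (Finset.sum_nonneg fun i _ => ?_)) <;>
    split_ifs <;> simp

theorem softPenalty_eq_zero_iff {z : E} (hz : z ∈ hardSet c g sE sI) :
    softPenalty c g sE sI z = 0 ↔ (∀ i, c i z = 0) ∧ ∀ j, g j z ≤ 0 := by
  constructor
  · intro h
    refine ⟨fun i => ?_, fun j => ?_⟩
    · by_cases hi : sE i
      · have := eq_term_le_softPenalty (c := c) (g := g) (sE := sE) (sI := sI) z i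
        rw [h, if_pos hi] at this
        exact abs_nonpos_iff.1 this
      · exact hz.1 i hi
    · by_cases hj : sI j
      · have := ineq_term_le_softPenalty (c := c) (g := g) (sE := sE) (sI := sI) z j
        rw [h, if_pos hj] at this
        exact (le_max_right _ _).trans (abs_nonpos_iff.1 this).le
      · exact hz.2 j hj
  · rintro ⟨h1, h2⟩
    simp [softPenalty, h1, h2]

end SoftPenalty

section ExactPenalty

variable {E : Type} [NormedAddCommGroup E] [NormedSpace ℝ E]

/-- Finitely many real functions with linearly independent strict derivatives at `z₀` can be steered
to any nearby values from any nearby point, over a distance proportional to the change of values. -/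
theorem exists_steering_of_linearIndependent [CompleteSpace E] {ι : Type} [Fintype ι]
    {G : ι → E → ℝ} {G' : ι → E →L[ℝ] ℝ} {z₀ : E}
    (hG : ∀ i, HasStrictFDerivAt (G i) (G' i) z₀) (hli : LinearIndependent ℝ G') :
    ∃ κ ρ : ℝ, 0 < κ ∧ 0 < ρ ∧ ∀ᶠ z in 𝓝 z₀, ∀ d : ι → ℝ, ‖d‖ ≤ ρ →
      ∃ z', (∀ i, G i z' = G i z + d i) ∧ ‖z' - z‖ ≤ κ * ‖d‖ := by
  classical
  have hsurj : (ContinuousLinearMap.pi G').range = ⊤ := by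
    let f : ι → E → ℝ := fun i z => G' i z
    have hf : LinearIndependent ℝ f :=
      hli.map' ({ toFun := fun v z => v z, map_add' := fun _ _ => rfl,
                  map_smul' := fun _ _ => rfl } :
        (E →L[ℝ] ℝ) →ₗ[ℝ] (E → ℝ)) (LinearMap.ker_eq_bot.2 DFunLike.coe_injective)
    rw [← span_flip_eq_top_iff_linearIndependent] at hf
    rw [eq_top_iff, ← hf, Submodule.span_le]
    rintro _ ⟨z, rfl⟩
    exact ⟨z, rfl⟩
  have hs : HasStrictFDerivAt (fun z i => G i z) (ContinuousLinearMap.pi G') z₀ :=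
    hasStrictFDerivAt_pi.2 hG
  let R := (ContinuousLinearMap.pi G').nonlinearRightInverseOfSurjective hsurj
  have hR : 0 < R.nnnorm := ContinuousLinearMap.nonlinearRightInverseOfSurjective_nnnorm_pos _ _
  obtain ⟨s, hs₀, happ⟩ := hs.approximates_deriv_on_nhds (c := R.nnnorm⁻¹ / 2)
    (Or.inr (by positivity))
  obtain ⟨r, hr, hrs⟩ := Metric.mem_nhds_iff.1 hs₀
  have hRr : (0 : ℝ) < R.nnnorm := hR
  refine ⟨2 * R.nnnorm, r / 2 / (2 * R.nnnorm) / 2, by positivity, by positivity, ?_⟩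
  filter_upwards [Metric.ball_mem_nhds z₀ (half_pos hr)] with z hz d hd
  have hball : Metric.closedBall z (2 * R.nnnorm * ‖d‖) ⊆ s := by
    refine Subset.trans (fun x hx => ?_) hrs
    rw [Metric.mem_closedBall] at hx
    rw [Metric.mem_ball] at hz ⊢
    have : 2 * R.nnnorm * ‖d‖ < r / 2 := by
      calc 2 * R.nnnorm * ‖d‖ ≤ 2 * R.nnnorm * (r / 2 / (2 * R.nnnorm) / 2) := by gcongr
        _ = r / 4 := by field_simp; norm_num
        _ < r / 2 := by linarith
    linarith [dist_triangle x z z₀]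
  obtain ⟨z', hz', hGz'⟩ := happ.surjOn_closedBall_of_nonlinearRightInverse R
    (by positivity) hball (show (fun i => G i z + d i) ∈ _ by
      rw [Metric.mem_closedBall, dist_eq_norm]
      have h1 : ((fun i => G i z + d i) - fun i => G i z) = d := by ext i; simp
      rw [h1]
      apply le_of_eq
      push_cast
      field_simp
      norm_num)
  exact ⟨z', fun i => congrFun hGz' i, by rwa [← dist_eq_norm, ← Metric.mem_closedBall]⟩

variable {I J : Type} [Fintype I] [Fintype J] {c : I → E → ℝ} {g : J → E → ℝ}
  {sE : I → Prop} {sI : J → Prop} [DecidablePred sE] [DecidablePred sI]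

/-- Near a feasible point at which the gradients of the active constraints are linearly
independent, the `ℓ₁` penalty can be reduced by any fraction `t` without leaving the set described
by the remaining constraints, by a step of length at most proportional to the reduction. -/
theorem exists_penalty_descent [CompleteSpace E] {c' : I → E →L[ℝ] ℝ} {g' : J → E →L[ℝ] ℝ} {z₀ : E}
    (hc : ∀ i, HasStrictFDerivAt (c i) (c' i) z₀) (hg : ∀ j, HasStrictFDerivAt (g j) (g' j) z₀)
    (hli : LinearIndependent ℝ (Sum.elim c' fun j : {j // g j z₀ = 0} => g' j.1))
    (hc₀ : ∀ i, c i z₀ = 0) (hg₀ : ∀ j, g j z₀ ≤ 0) :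
    ∃ κ : ℝ, 0 < κ ∧ ∀ r : ℝ, 0 < r → ∀ᶠ z in 𝓝 z₀, z ∈ hardSet c g sE sI → ∀ t ∈ Icc (0 : ℝ) 1,
      ∃ z' ∈ hardSet c g sE sI, ‖z' - z‖ ≤ κ * (t * softPenalty c g sE sI z) ∧
        softPenalty c g sE sI z' ≤ (1 - t) * softPenalty c g sE sI z ∧ ‖z' - z₀‖ < r := by
  classical
  obtain ⟨κ, ρ, hκ, hρ, hsteer⟩ := exists_steering_of_linearIndependent (z₀ := z₀)
    (G := Sum.elim c fun j : {j // g j z₀ = 0} => g j.1)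
    (by rintro (i | j); exacts [hc i, hg j]) hli
  refine ⟨κ, hκ, fun r hr => ?_⟩
  have hinact : ∀ᶠ z in 𝓝 z₀, ∀ j, g j z₀ ≠ 0 → g j z < 0 := by
    refine eventually_all.2 fun j => ?_
    by_cases hj : g j z₀ = 0
    · simp [hj]
    · filter_upwards [(hg j).continuousAt.eventually_lt continuousAt_const
        (lt_of_le_of_ne (hg₀ j) hj)] with z hz _ using hz
  obtain ⟨r₁, hr₁, hball⟩ := Metric.eventually_nhds_iff.1 hinact
  set r₂ := min r r₁ with hr₂
  have hr₂0 : 0 < r₂ := lt_min hr hr₁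
  have hpen : Tendsto (softPenalty c g sE sI) (𝓝 z₀) (𝓝 0) := by
    have h0 : softPenalty c g sE sI z₀ = 0 := by simp [softPenalty, hc₀, hg₀]
    rw [← h0]
    refine ContinuousAt.tendsto (ContinuousAt.add ?_ ?_)
    · refine tendsto_finsetSum _ fun i _ => ?_
      by_cases hi : sE i
      · simpa [hi] using (hc i).continuousAt.abs.tendsto
      · simp [hi]
    · refine tendsto_finsetSum _ fun j _ => ?_
      by_cases hj : sI j
      · simpa only [if_pos hj] using (tendsto_const_nhds.max (hg j).continuousAt.tendsto)
      · simp [hj]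
  have hκρ : 0 < min ρ (r₂ / 2 / κ) := lt_min hρ (by positivity)
  filter_upwards [hsteer, hpen.eventually (gt_mem_nhds hκρ),
    Metric.ball_mem_nhds z₀ (half_pos hr₂0)] with z hz hpz hzr hzH t ht
  have hpρ := hpz.le.trans (min_le_left _ _)
  have hpr : κ * softPenalty c g sE sI z < r₂ / 2 := by
    have := hpz.trans_le (min_le_right _ _)
    rwa [lt_div_iff₀' hκ] at this
  have hp0 : 0 ≤ softPenalty c g sE sI z := softPenalty_nonneg z
  set d : I ⊕ {j // g j z₀ = 0} → ℝ := Sum.elim (fun i => -t * if sE i then c i z else 0)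
    (fun j => -t * if sI j.1 then max 0 (g j.1 z) else 0) with hd
  have hdn : ‖d‖ ≤ t * softPenalty c g sE sI z := by
    refine (pi_norm_le_iff_of_nonneg (mul_nonneg ht.1 hp0)).2 ?_
    rintro (i | j)
    · simp only [hd, Sum.elim_inl, Real.norm_eq_abs, abs_mul, abs_neg, abs_of_nonneg ht.1]
      exact mul_le_mul_of_nonneg_left (eq_term_le_softPenalty z i) ht.1
    · simp only [hd, Sum.elim_inr, Real.norm_eq_abs, abs_mul, abs_neg, abs_of_nonneg ht.1]
      exact mul_le_mul_of_nonneg_left (ineq_term_le_softPenalty z j.1) ht.1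
  have htp : t * softPenalty c g sE sI z ≤ softPenalty c g sE sI z :=
    mul_le_of_le_one_left hp0 ht.2
  obtain ⟨z', hz', hzz'⟩ := hz d (hdn.trans (htp.trans hpρ))
  have hstep : ‖z' - z‖ ≤ κ * (t * softPenalty c g sE sI z) :=
    hzz'.trans (mul_le_mul_of_nonneg_left hdn hκ.le)
  have hnear : ‖z' - z₀‖ < r₂ := by
    have h1 : ‖z - z₀‖ < r₂ / 2 := by rwa [← dist_eq_norm]
    have h2 := norm_sub_le_norm_sub_add_norm_sub z' z z₀
    have h3 := mul_le_mul_of_nonneg_left htp hκ.le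
    linarith
  have hneg : ∀ j, g j z₀ ≠ 0 → g j z' < 0 :=
    hball (by rw [dist_eq_norm]; exact hnear.trans_le (min_le_right _ _))
  refine ⟨z', ⟨fun i hi => ?_, fun j hj => ?_⟩, hstep, ?_, hnear.trans_le (min_le_left _ _)⟩
  · have := hz' (Sum.inl i)
    simpa [hd, hi, hzH.1 i hi] using this
  · by_cases hj0 : g j z₀ = 0
    · have := hz' (Sum.inr ⟨j, hj0⟩)
      simp only [hd, Sum.elim_inr, if_neg hj, mul_zero, add_zero] at this
      exact this ▸ hzH.2 j hj
    · exact (hneg j hj0).le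
  · have h1t : 0 ≤ 1 - t := sub_nonneg.2 ht.2
    simp only [softPenalty, mul_add, Finset.mul_sum]
    refine add_le_add (Finset.sum_le_sum fun i _ => ?_) (Finset.sum_le_sum fun j _ => ?_)
    · by_cases hi : sE i
      · have := hz' (Sum.inl i)
        simp only [hd, Sum.elim_inl, if_pos hi] at this
        rw [if_pos hi, if_pos hi, this, show c i z + -t * c i z = (1 - t) * c i z by ring, abs_mul,
          abs_of_nonneg h1t]
      · simp [hi]
    · by_cases hj : sI j
      · rw [if_pos hj, if_pos hj]
        refine max_le (mul_nonneg h1t (le_max_left _ _)) ?_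
        by_cases hj0 : g j z₀ = 0
        · have := hz' (Sum.inr ⟨j, hj0⟩)
          simp only [hd, Sum.elim_inr, if_pos hj] at this
          rw [this]
          have := le_max_right 0 (g j z)
          linarith
        · exact (hneg j hj0).le.trans (mul_nonneg h1t (le_max_left _ _))
      · simp [hj]

/-- A constrained local minimizer is a local minimizer of the exact penalty function for all large
penalty weights. -/
theorem isLocalMin_penalized_of_linearIndependent [CompleteSpace E]
    {c' : I → E →L[ℝ] ℝ} {g' : J → E →L[ℝ] ℝ} {z₀ : E} {obj : E → ℝ} {obj' : E →L[ℝ] ℝ}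
    (hc : ∀ i, HasStrictFDerivAt (c i) (c' i) z₀) (hg : ∀ j, HasStrictFDerivAt (g j) (g' j) z₀)
    (hli : LinearIndependent ℝ (Sum.elim c' fun j : {j // g j z₀ = 0} => g' j.1))
    (hc₀ : ∀ i, c i z₀ = 0) (hg₀ : ∀ j, g j z₀ ≤ 0) (hobj : HasStrictFDerivAt obj obj' z₀)
    (hmin : IsLocalMinOn obj {z | (∀ i, c i z = 0) ∧ ∀ j, g j z ≤ 0} z₀) :
    ∃ γ₀ : ℝ, 0 < γ₀ ∧ ∀ γ : ℝ, γ₀ ≤ γ → IsLocalMin (fun z =>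
      ((obj z + γ * softPenalty c g sE sI z : ℝ) : EReal) + indicatorFun (hardSet c g sE sI) z)
      z₀ := by
  obtain ⟨κ, hκ, hdesc⟩ := exists_penalty_descent (sE := sE) (sI := sI) hc hg hli hc₀ hg₀
  obtain ⟨ℓ, s, hs, hlip⟩ := hobj.exists_lipschitzOnWith
  obtain ⟨r, hr, hrs⟩ := Metric.mem_nhds_iff.1
    (inter_mem hs (eventually_nhdsWithin_iff.1 hmin))
  refine ⟨ℓ * κ + 1, by positivity, fun γ hγ => ?_⟩
  have h₀ : z₀ ∈ hardSet c g sE sI := ⟨fun i _ => hc₀ i, fun j _ => hg₀ j⟩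
  have hp₀ : softPenalty c g sE sI z₀ = 0 := (softPenalty_eq_zero_iff h₀).2 ⟨hc₀, hg₀⟩
  filter_upwards [hdesc r hr, hs] with z hz hzs
  by_cases hzH : z ∈ hardSet c g sE sI
  · obtain ⟨z', hz'H, hstep, hpz', hnear⟩ := hz hzH 1 ⟨zero_le_one, le_rfl⟩
    have hpz'0 : softPenalty c g sE sI z' = 0 :=
      le_antisymm (by simpa using hpz') (softPenalty_nonneg z')
    obtain ⟨hz's, hz'min⟩ := hrs (show z' ∈ Metric.ball z₀ r by
      rwa [Metric.mem_ball, dist_eq_norm])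
    have h1 : obj z₀ ≤ obj z' := hz'min ((softPenalty_eq_zero_iff hz'H).1 hpz'0)
    have h2 : obj z' - obj z ≤ ℓ * ‖z' - z‖ := by
      have := hlip.dist_le_mul z' hz's z hzs
      rw [dist_eq_norm, dist_eq_norm] at this
      exact (le_abs_self _).trans this
    have h3 : (ℓ : ℝ) * ‖z' - z‖ ≤ ℓ * (κ * softPenalty c g sE sI z) := by
      gcongr
      simpa using hstep
    have h4 : (ℓ * κ : ℝ) * softPenalty c g sE sI z ≤ γ * softPenalty c g sE sI z :=
      mul_le_mul_of_nonneg_right (by linarith) (softPenalty_nonneg z)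
    simp only [indicatorFun, if_pos h₀, if_pos hzH, add_zero, hp₀, mul_zero]
    exact_mod_cast (by linarith : obj z₀ ≤ obj z + γ * softPenalty c g sE sI z)
  · simp only [indicatorFun, if_neg hzH, EReal.coe_add_top, le_top]

/-- Near a feasible point with linearly independent active gradients, all stationary points of the
exact penalty function are feasible once the penalty weight is large: where the penalty is positive,
the penalized objective decreases with slope greater than one along short steps, and subgradients
are therefore bounded away from zero. -/
theorem stationary_penalized_feasible_of_linearIndependent [CompleteSpace E]
    {c' : I → E →L[ℝ] ℝ} {g' : J → E →L[ℝ] ℝ} {z₀ : E} {obj : E → ℝ} {obj' : E →L[ℝ] ℝ}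
    (hc : ∀ i, HasStrictFDerivAt (c i) (c' i) z₀) (hg : ∀ j, HasStrictFDerivAt (g j) (g' j) z₀)
    (hli : LinearIndependent ℝ (Sum.elim c' fun j : {j // g j z₀ = 0} => g' j.1))
    (hc₀ : ∀ i, c i z₀ = 0) (hg₀ : ∀ j, g j z₀ ≤ 0) (hobj : HasStrictFDerivAt obj obj' z₀)
    (hobjc : Continuous obj) :
    ∃ γ₀ σ₀ : ℝ, 0 < γ₀ ∧ 0 < σ₀ ∧ ∀ γ : ℝ, γ₀ ≤ γ → ∀ z : E, IsStationary (fun z =>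
      ((obj z + γ * softPenalty c g sE sI z : ℝ) : EReal) + indicatorFun (hardSet c g sE sI) z) z →
      ‖z - z₀‖ ≤ σ₀ → (∀ i, c i z = 0) ∧ ∀ j, g j z ≤ 0 := by
  obtain ⟨κ, hκ, hdesc⟩ := exists_penalty_descent (sE := sE) (sI := sI) hc hg hli hc₀ hg₀
  obtain ⟨ℓ, s, hs, hlip⟩ := hobj.exists_lipschitzOnWith
  obtain ⟨r, hr, hrs⟩ := Metric.mem_nhds_iff.1 hs
  obtain ⟨σ, hσ, hσd⟩ := Metric.mem_nhds_iff.1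
    (inter_mem (Metric.ball_mem_nhds z₀ hr) (hdesc r hr))
  refine ⟨(ℓ + 3) * κ, σ / 2, by positivity, by positivity, fun γ hγ z hstat hzσ => ?_⟩
  set pen := softPenalty c g sE sI with hpen
  set H := hardSet c g sE sI with hH
  have hfin : ∀ z, ((obj z + γ * pen z : ℝ) : EReal) + indicatorFun H z ≠ ⊤ → z ∈ H := by
    intro z hz
    by_contra hzH
    exact hz (by simp only [indicatorFun, if_neg hzH, EReal.coe_add_top])
  have hval : ∀ z ∈ H, ((obj z + γ * pen z : ℝ) : EReal) + indicatorFun H z =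
      ((obj z + γ * pen z : ℝ) : EReal) := by
    intro z hz
    simp [indicatorFun, hz]
  obtain ⟨htop, -, zs, vs, hzs, hΘ, hvs, hv⟩ := hstat
  have hzH := hfin z htop
  have hzsH : ∀ n, zs n ∈ H := fun n => hfin _ (hvs n).1
  have hγ0 : 0 < γ := lt_of_lt_of_le (by positivity) hγ
  refine (softPenalty_eq_zero_iff hzH).1 (le_antisymm (le_of_not_gt fun hpos => ?_)
    (softPenalty_nonneg z))
  -- The values of the penalty along the sequence converge to its value at the limit.
  have hpenlim : Tendsto (fun n => pen (zs n)) atTop (𝓝 (pen z)) := by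
    have h1 : Tendsto (fun n => obj (zs n) + γ * pen (zs n)) atTop (𝓝 (obj z + γ * pen z)) := by
      rw [← EReal.tendsto_coe]
      simp only [hval z hzH, hval _ (hzsH _)] at hΘ
      exact hΘ
    have h2 := (h1.sub ((hobjc.tendsto z).comp hzs)).const_mul γ⁻¹
    have h3 : γ⁻¹ * (obj z + γ * pen z - obj z) = pen z := by field_simp; ring
    rw [h3] at h2
    refine h2.congr fun n => ?_
    simp only [Function.comp_apply]
    field_simp
    ring
  have hzball : z ∈ Metric.ball z₀ σ := by
    rw [Metric.mem_ball, dist_eq_norm]; linarith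
  obtain ⟨n, hn⟩ := ((hpenlim.eventually (lt_mem_nhds hpos)).and
    ((hzs.eventually (Metric.isOpen_ball.mem_nhds hzball)).and
    ((hv.norm.eventually (gt_mem_nhds (by simp : ‖(0 : E →L[ℝ] ℝ)‖ < 1)))))).exists
  obtain ⟨hpn, hnball, hvn⟩ := hn
  obtain ⟨hnr, hnd⟩ := hσd hnball
  have hnd := hnd (hzsH n)
  set w := zs n with hw
  set v := vs n with hv'
  have hpn : 0 < pen w := hpn
  -- A short step of the descent lemma contradicts the subgradient inequality.
  obtain ⟨e, he, hsub⟩ := Metric.eventually_nhds_iff.1 ((hvs n).2.2 1 one_pos)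
  set t := min 1 (e / 2 / (κ * pen w)) with ht
  have hκp : 0 < κ * pen w := mul_pos hκ hpn
  have ht0 : 0 < t := lt_min one_pos (by positivity)
  obtain ⟨w', hw'H, hstep, hpw', hnear⟩ := hnd t ⟨ht0.le, min_le_left _ _⟩
  have hclose : dist w' w < e := by
    rw [dist_eq_norm]
    refine hstep.trans_lt ?_
    calc κ * (t * pen w) = t * (κ * pen w) := by ring
      _ ≤ e / 2 / (κ * pen w) * (κ * pen w) := by gcongr; exact min_le_right _ _
      _ = e / 2 := by field_simp
      _ < e := by linarith
  have h1 := hsub hclose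
  beta_reduce at h1
  rw [hval w' hw'H, hval (zs n) (hzsH n)] at h1
  have h1 : obj w + γ * pen w + (v (w' - w) - 1 * ‖w' - w‖) ≤ obj w' + γ * pen w' := by
    exact_mod_cast h1
  have h2 : obj w' - obj w ≤ ℓ * ‖w' - w‖ := by
    have := hlip.dist_le_mul w' (hrs (by rwa [Metric.mem_ball, dist_eq_norm])) w (hrs hnr)
    rw [dist_eq_norm, dist_eq_norm] at this
    exact (le_abs_self _).trans this
  have h3 : -‖w' - w‖ ≤ v (w' - w) := by
    have h := (v.le_opNorm (w' - w)).trans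
      (mul_le_mul_of_nonneg_right (show ‖v‖ ≤ 1 from le_of_lt hvn) (norm_nonneg _))
    rw [one_mul, Real.norm_eq_abs] at h
    exact (abs_le.1 h).1
  have h4 : γ * pen w' ≤ γ * ((1 - t) * pen w) := mul_le_mul_of_nonneg_left hpw' hγ0.le
  have h5 : ((ℓ : ℝ) + 2) * ‖w' - w‖ ≤ (ℓ + 2) * (κ * (t * pen w)) := by gcongr
  have h6 : (ℓ + 3) * κ * (t * pen w) ≤ γ * (t * pen w) := by gcongr
  have h7 : 0 < κ * (t * pen w) := by positivity
  linarith

end ExactPenalty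

/-! ### Volterra equations on a compact interval -/

section Volterra

variable {V W C : Type*} [NormedAddCommGroup V] [NormedAddCommGroup W] [NormedAddCommGroup C]
  {a b : ℝ}

/-- `g` is bounded on `[a, b]`, and measurable there up to null sets. -/
structure BddMeasOn (a b : ℝ) (g : ℝ → V) : Prop where
  meas : AEStronglyMeasurable g (volume.restrict (Icc a b))
  bdd : ∃ B, ∀ σ ∈ Icc a b, ‖g σ‖ ≤ B

namespace BddMeasOn

theorem exists_pos_bound {g : ℝ → V} (h : BddMeasOn a b g) :
    ∃ B, 0 < B ∧ ∀ σ ∈ Icc a b, ‖g σ‖ ≤ B := by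
  obtain ⟨B, hB⟩ := h.bdd
  exact ⟨max B 1, by positivity, fun σ hσ => (hB σ hσ).trans (le_max_left _ _)⟩

theorem intervalIntegrable {g : ℝ → V} (h : BddMeasOn a b g) {c : ℝ} (hc : c ∈ Icc a b) :
    IntervalIntegrable g volume a c := by
  obtain ⟨B, hB⟩ := h.bdd
  rw [intervalIntegrable_iff_integrableOn_Ioc_of_le hc.1]
  have hsub : Ioc a c ⊆ Icc a b := fun x hx => ⟨hx.1.le, hx.2.trans hc.2⟩
  have hm : AEStronglyMeasurable g (volume.restrict (Ioc a c)) :=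
    h.meas.mono_measure (Measure.restrict_mono hsub le_rfl)
  refine ⟨hm, HasFiniteIntegral.of_bounded (C := B) ?_⟩
  exact (ae_restrict_iff' measurableSet_Ioc).2 (Eventually.of_forall fun x hx => hB x (hsub hx))

theorem _root_.ContinuousOn.bddMeasOn {g : ℝ → V} (h : ContinuousOn g (Icc a b)) :
    BddMeasOn a b g := by
  refine ⟨?_, isCompact_Icc.exists_bound_of_continuousOn h⟩
  exact ContinuousOn.aestronglyMeasurable_of_isCompact h isCompact_Icc measurableSet_Icc

theorem prodMk {g : ℝ → V} {h : ℝ → W} (hg : BddMeasOn a b g) (hh : BddMeasOn a b h) :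
    BddMeasOn a b fun σ => (g σ, h σ) := by
  obtain ⟨B, hB⟩ := hg.bdd
  obtain ⟨B', hB'⟩ := hh.bdd
  exact ⟨hg.meas.prodMk hh.meas, max B B', fun σ hσ => max_le_max (hB σ hσ) (hB' σ hσ)⟩

theorem comp [ProperSpace V] {F : V → W} (hF : Continuous F) {g : ℝ → V} (hg : BddMeasOn a b g) :
    BddMeasOn a b fun σ => F (g σ) := by
  obtain ⟨B, hB⟩ := hg.bdd
  obtain ⟨B', hB'⟩ := (isCompact_closedBall (0 : V) B).exists_bound_of_continuousOn hF.continuousOn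
  exact ⟨hF.comp_aestronglyMeasurable hg.meas, B', fun σ hσ => hB' _ (by simpa using hB σ hσ)⟩

theorem add {g h : ℝ → V} (hg : BddMeasOn a b g) (hh : BddMeasOn a b h) :
    BddMeasOn a b fun σ => g σ + h σ := by
  obtain ⟨B, hB⟩ := hg.bdd
  obtain ⟨B', hB'⟩ := hh.bdd
  exact ⟨hg.meas.add hh.meas, B + B', fun σ hσ => (norm_add_le _ _).trans
    (add_le_add (hB σ hσ) (hB' σ hσ))⟩

theorem sum {ι : Type*} (s : Finset ι) {g : ι → ℝ → V} (hg : ∀ i ∈ s, BddMeasOn a b (g i)) :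
    BddMeasOn a b fun σ => ∑ i ∈ s, g i σ := by
  classical
  induction s using Finset.induction_on with
  | empty => simpa using continuousOn_const.bddMeasOn
  | insert i s hi ih =>
    simp only [Finset.sum_insert hi]
    exact (hg i (Finset.mem_insert_self i s)).add
      (ih fun j hj => hg j (Finset.mem_insert_of_mem hj))

theorem smul_const [NormedSpace ℝ V] {g : ℝ → ℝ} (hg : BddMeasOn a b g) (v : V) :
    BddMeasOn a b fun σ => g σ • v := by
  obtain ⟨B, hB⟩ := hg.bdd
  refine ⟨hg.meas.smul_const v, B * ‖v‖, fun σ hσ => ?_⟩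
  rw [norm_smul]
  gcongr
  exact hB σ hσ

theorem sub {g h : ℝ → V} (hg : BddMeasOn a b g) (hh : BddMeasOn a b h) :
    BddMeasOn a b fun σ => g σ - h σ := by
  obtain ⟨B, hB⟩ := hg.bdd
  obtain ⟨B', hB'⟩ := hh.bdd
  exact ⟨hg.meas.sub hh.meas, B + B', fun σ hσ => (norm_sub_le _ _).trans
    (add_le_add (hB σ hσ) (hB' σ hσ))⟩

theorem clm_apply [NormedSpace ℝ V] [NormedSpace ℝ W] {A : ℝ → V →L[ℝ] W} {g : ℝ → V}
    (hA : BddMeasOn a b A) (hg : BddMeasOn a b g) : BddMeasOn a b fun σ => A σ (g σ) := by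
  obtain ⟨B, hB0, hB⟩ := hA.exists_pos_bound
  obtain ⟨B', hB'⟩ := hg.bdd
  refine ⟨isBoundedBilinearMap_apply.continuous.comp_aestronglyMeasurable
    (hA.meas.prodMk hg.meas), B * B', fun σ hσ => ((A σ).le_opNorm _).trans ?_⟩
  gcongr
  · exact hB σ hσ
  · exact hB' σ hσ

theorem clm_apply_const [NormedSpace ℝ V] [NormedSpace ℝ W] {A : ℝ → V →L[ℝ] W}
    (hA : BddMeasOn a b A) (v : V) : BddMeasOn a b fun σ => A σ v :=
  hA.clm_apply continuousOn_const.bddMeasOn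

theorem mono {g : ℝ → V} (h : BddMeasOn a b g) {a' b' : ℝ} (ha : a ≤ a') (hb : b' ≤ b) :
    BddMeasOn a' b' g := by
  have hsub := Icc_subset_Icc ha hb
  exact ⟨h.meas.mono_measure (Measure.restrict_mono hsub le_rfl),
    h.bdd.imp fun B hB σ hσ => hB σ (hsub hσ)⟩

end BddMeasOn

/-- A self-map `T` of `C([a, b], W)` with `‖T φ - T ψ‖(τ) ≤ K ∫ₐ^τ ‖φ - ψ‖` has exactly one fixed
point, because some iterate of it is a contraction. -/
theorem existsUnique_fixedPoint_of_volterra [CompleteSpace W] (hab : a ≤ b) {K : ℝ} (hK : 0 ≤ K)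
    (T : C(Icc a b, W) → C(Icc a b, W))
    (hT : ∀ φ ψ, ∀ τ : Icc a b, ‖T φ τ - T ψ τ‖ ≤
      K * ∫ σ in a..τ, ‖IccExtend hab φ σ - IccExtend hab ψ σ‖) :
    ∃! φ, T φ = φ := by
  have hiter : ∀ n φ ψ, ∀ τ : Icc a b, ‖T^[n] φ τ - T^[n] ψ τ‖ ≤
      (K * (τ - a)) ^ n / n.factorial * dist φ ψ := by
    intro n
    induction n with
    | zero =>
      intro φ ψ τ
      simpa [dist_eq_norm] using ContinuousMap.dist_apply_le_dist (f := φ) (g := ψ) τ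
    | succ n ih =>
      intro φ ψ τ
      rw [Function.iterate_succ_apply', Function.iterate_succ_apply']
      refine (hT _ _ τ).trans ?_
      have hτ : a ≤ τ := τ.2.1
      have h1 : ∫ σ in a..τ, ‖IccExtend hab (T^[n] φ) σ - IccExtend hab (T^[n] ψ) σ‖ ≤
          ∫ σ in a..τ, K ^ n / n.factorial * dist φ ψ * (σ - a) ^ n := by
        refine intervalIntegral.integral_mono_on hτ ?_ ?_ fun σ hσ => ?_
        · exact ((map_continuous _).Icc_extend'.sub
            (map_continuous _).Icc_extend').norm.intervalIntegrable _ _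
        · exact Continuous.intervalIntegrable (by fun_prop) _ _
        · have hσ' : σ ∈ Icc a b := ⟨hσ.1, hσ.2.trans τ.2.2⟩
          rw [IccExtend_of_mem hab _ hσ', IccExtend_of_mem hab _ hσ']
          refine (ih φ ψ ⟨σ, hσ'⟩).trans (le_of_eq ?_)
          simp only [mul_pow]
          ring
      refine (mul_le_mul_of_nonneg_left h1 hK).trans (le_of_eq ?_)
      rw [intervalIntegral.integral_const_mul,
        intervalIntegral.integral_comp_sub_right (fun x => x ^ n) a, integral_pow, sub_self,
        Nat.factorial_succ]
      push_cast
      have : (n.factorial : ℝ) ≠ 0 := by positivity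
      rw [mul_pow]
      field_simp
      ring
  obtain ⟨n, hn⟩ := ((FloorSemiring.tendsto_pow_div_factorial_atTop (K * (b - a))).eventually
    (gt_mem_nhds one_pos)).exists
  have h0 : 0 ≤ K * (b - a) := mul_nonneg hK (sub_nonneg.2 hab)
  have hcontr : ContractingWith ⟨(K * (b - a)) ^ n / n.factorial, by positivity⟩ T^[n] := by
    refine ⟨by exact_mod_cast hn, LipschitzWith.of_dist_le_mul fun φ ψ => ?_⟩
    change dist _ _ ≤ (K * (b - a)) ^ n / n.factorial * dist φ ψ
    refine (ContinuousMap.dist_le (by positivity)).2 fun τ => ?_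
    rw [dist_eq_norm]
    refine (hiter n φ ψ τ).trans ?_
    have h2 : 0 ≤ K * (τ - a) := mul_nonneg hK (sub_nonneg.2 τ.2.1)
    gcongr
    exact τ.2.2
  refine ⟨_, hcontr.isFixedPt_fixedPoint_iterate, fun φ hφ => ?_⟩
  exact hcontr.fixedPoint_unique (Function.IsFixedPt.iterate hφ n)

variable [NormedSpace ℝ W]

open Classical in
/-- The primitive on `[a, b]`, vanishing at `a`, of an integrable function; `0` if the function is
not integrable. -/
def prim (a b : ℝ) (g : ℝ → W) : C(Icc a b, W) :=
  if h : IntervalIntegrable g volume a b ∧ a ≤ b then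
    ⟨fun τ => ∫ σ in a..τ, g σ, by
      have := intervalIntegral.continuousOn_primitive_interval' h.1 left_mem_uIcc
      rw [uIcc_of_le h.2] at this
      exact continuousOn_iff_continuous_domRestrict.1 this⟩
  else 0

theorem prim_apply (hab : a ≤ b) {g : ℝ → W} (hg : BddMeasOn a b g) (τ : Icc a b) :
    prim a b g τ = ∫ σ in a..τ, g σ := by
  rw [prim, dif_pos ⟨hg.intervalIntegrable (right_mem_Icc.2 hab), hab⟩]
  rfl

theorem norm_prim_le (hab : a ≤ b) {g : ℝ → W} (hg : BddMeasOn a b g) {B : ℝ}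
    (hB : ∀ σ ∈ Icc a b, ‖g σ‖ ≤ B) : ‖prim a b g‖ ≤ (b - a) * B := by
  have hB0 : 0 ≤ B := (norm_nonneg _).trans (hB a ⟨le_rfl, hab⟩)
  refine (ContinuousMap.norm_le _ (mul_nonneg (sub_nonneg.2 hab) hB0)).2 fun τ => ?_
  rw [prim_apply hab hg]
  refine (intervalIntegral.norm_integral_le_of_norm_le_const (C := B) fun σ hσ => ?_).trans ?_
  · rw [uIoc_of_le τ.2.1] at hσ
    exact hB σ ⟨hσ.1.le, hσ.2.trans τ.2.2⟩
  · rw [abs_of_nonneg (sub_nonneg.2 τ.2.1), mul_comm]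
    gcongr
    exact τ.2.2

/-- `φ` solves `φ' = G(τ, φ)`, `φ(a) = w` on `[a, b]` in the integrated sense. -/
def IsMildSol (G : ℝ → W → W) (a b : ℝ) (w : W) (φ : ℝ → W) : Prop :=
  ContinuousOn φ (Icc a b) ∧ ∀ τ ∈ Icc a b, φ τ = w + ∫ σ in a..τ, G σ (φ σ)

/-- If the right-hand side is Lipschitz continuous in the state, there is exactly one continuous
solution of the integral equation. -/
theorem existsUnique_solution_of_lipschitz [CompleteSpace W] (hab : a ≤ b) {G : ℝ → W → W} {K : ℝ}
    (hK : 0 ≤ K)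
    (hG : ∀ φ : C(Icc a b, W), BddMeasOn a b fun σ => G σ (IccExtend hab φ σ))
    (hlip : ∀ σ ∈ Icc a b, ∀ x y, ‖G σ x - G σ y‖ ≤ K * ‖x - y‖) (w : W) :
    ∃! φ : C(Icc a b, W), ∀ τ : Icc a b, φ τ = w + ∫ σ in a..τ, G σ (IccExtend hab φ σ) := by
  have key := existsUnique_fixedPoint_of_volterra hab hK
    (fun φ => ContinuousMap.const _ w + prim a b fun σ => G σ (IccExtend hab φ σ))
    (fun φ ψ τ => by
      have hb : (τ : ℝ) ∈ Icc a b := τ.2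
      simp only [ContinuousMap.add_apply, ContinuousMap.const_apply, add_sub_add_left_eq_sub,
        prim_apply hab (hG _)]
      rw [← intervalIntegral.integral_sub ((hG φ).intervalIntegrable hb)
        ((hG ψ).intervalIntegrable hb), ← intervalIntegral.integral_const_mul]
      refine intervalIntegral.norm_integral_le_of_norm_le hb.1 ?_ ?_
      · exact Eventually.of_forall fun σ hσ => hlip σ ⟨hσ.1.le, hσ.2.trans hb.2⟩ _ _
      · exact (continuous_const.mul (φ.continuous.Icc_extend'.sub
          ψ.continuous.Icc_extend').norm).intervalIntegrable _ _)
  refine (existsUnique_congr fun φ => ?_).1 key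
  rw [ContinuousMap.ext_iff]
  refine forall_congr' fun τ => ?_
  simp only [ContinuousMap.add_apply, ContinuousMap.const_apply, prim_apply hab (hG _)]
  exact eq_comm

theorem IsMildSol.toContinuousMap (hab : a ≤ b) {G : ℝ → W → W} {w : W} {φ : ℝ → W}
    (h : IsMildSol G a b w φ) : ∃ Φ : C(Icc a b, W), (∀ τ : Icc a b, Φ τ = φ τ) ∧
      ∀ τ : Icc a b, Φ τ = w + ∫ σ in a..τ, G σ (IccExtend hab Φ σ) := by
  refine ⟨⟨(Icc a b).domRestrict φ, continuousOn_iff_continuous_domRestrict.1 h.1⟩, fun τ => rfl,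
    fun τ => (h.2 τ τ.2).trans ?_⟩
  congr 1
  refine intervalIntegral.integral_congr fun σ hσ => ?_
  rw [uIcc_of_le τ.2.1] at hσ
  have hσ' : σ ∈ Icc a b := ⟨hσ.1, hσ.2.trans τ.2.2⟩
  simp only [IccExtend_of_mem hab _ hσ']
  rfl

theorem isMildSol_IccExtend (hab : a ≤ b) {G : ℝ → W → W} {w : W} {Φ : C(Icc a b, W)}
    (h : ∀ τ : Icc a b, Φ τ = w + ∫ σ in a..τ, G σ (IccExtend hab Φ σ)) :
    IsMildSol G a b w (IccExtend hab Φ) := by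
  refine ⟨Φ.continuous.Icc_extend'.continuousOn, fun τ hτ => ?_⟩
  rw [IccExtend_of_mem hab _ hτ]
  exact h ⟨τ, hτ⟩

end Volterra

/-! ### Controlled differential equations -/

section Controlled

variable {W C : Type*} [NormedAddCommGroup W] [NormedSpace ℝ W] [FiniteDimensional ℝ W]
  [NormedAddCommGroup C] [NormedSpace ℝ C] [FiniteDimensional ℝ C] {a b : ℝ}

/-- A continuously differentiable map becomes globally Lipschitz when multiplied by a suitable
cutoff function. -/
theorem exists_cutoff_lipschitz {F : W × C → W} (hF : ContDiff ℝ 1 F) (R : ℝ) :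
    ∃ χ : W × C → ℝ, Continuous χ ∧ (∀ v, 0 ≤ χ v ∧ χ v ≤ 1) ∧ (∀ v, ‖v‖ ≤ R → χ v = 1) ∧
      ∃ K : ℝ, 0 ≤ K ∧ ∀ v v', ‖χ v • F v - χ v' • F v'‖ ≤ K * ‖v - v'‖ := by
  let χ : ContDiffBump (0 : W × C) := ⟨max R 1, max R 1 + 1, by positivity, by linarith⟩
  obtain ⟨K, hK⟩ := ContDiff.lipschitzWith_of_hasCompactSupport (𝕂 := ℝ)
    (χ.hasCompactSupport.smul_right (f' := F)) (χ.contDiff.smul hF) one_ne_zero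
  refine ⟨χ, χ.continuous, fun v => ⟨χ.nonneg, χ.le_one⟩, fun v hv => ?_, K, K.2, fun v v' => ?_⟩
  · exact χ.one_of_mem_closedBall (by
      rw [mem_closedBall_zero_iff]; exact hv.trans (le_max_left _ _))
  · simpa [dist_eq_norm] using hK.dist_le_mul v v'

theorem bddMeasOn_comp_control {V : Type*} [NormedAddCommGroup V] {F : W × C → V}
    (hF : Continuous F) {N : ℝ → C} (hN : BddMeasOn a b N) {φ : ℝ → W}
    (hφ : ContinuousOn φ (Icc a b)) : BddMeasOn a b fun σ => F (φ σ, N σ) :=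
  (hφ.bddMeasOn.prodMk hN).comp hF

theorem existsUnique_cutoff_solution (hab : a ≤ b) {F : W × C → W} {N : ℝ → C}
    (hN : BddMeasOn a b N) {χ : W × C → ℝ} (hF : Continuous fun v => χ v • F v) {K : ℝ}
    (hK : 0 ≤ K) (hlip : ∀ v v', ‖χ v • F v - χ v' • F v'‖ ≤ K * ‖v - v'‖) (w : W) :
    ∃! φ : C(Icc a b, W), ∀ τ : Icc a b, φ τ =
      w + ∫ σ in a..τ, χ (IccExtend hab φ σ, N σ) • F (IccExtend hab φ σ, N σ) := by
  refine existsUnique_solution_of_lipschitz hab (G := fun σ x => χ (x, N σ) • F (x, N σ)) hK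
    (fun φ => bddMeasOn_comp_control hF hN φ.continuous.Icc_extend'.continuousOn)
    (fun σ _ x y => (hlip _ _).trans (le_of_eq ?_)) w
  simp [Prod.norm_def]

/-- Solutions of a controlled differential equation are unique. -/
theorem IsMildSol.eqOn (hab : a ≤ b) {F : W × C → W} (hF : ContDiff ℝ 1 F) {N : ℝ → C}
    (hN : BddMeasOn a b N) {w : W} {φ ψ : ℝ → W}
    (hφ : IsMildSol (fun σ x => F (x, N σ)) a b w φ)
    (hψ : IsMildSol (fun σ x => F (x, N σ)) a b w ψ) : EqOn φ ψ (Icc a b) := by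
  obtain ⟨B₁, hB₁⟩ := (hφ.1.bddMeasOn.prodMk hN).bdd
  obtain ⟨B₂, hB₂⟩ := (hψ.1.bddMeasOn.prodMk hN).bdd
  obtain ⟨χ, hχ, -, hone, K, hK, hlip⟩ := exists_cutoff_lipschitz hF (max B₁ B₂)
  have hcut : ∀ θ : ℝ → W, (∀ σ ∈ Icc a b, ‖(θ σ, N σ)‖ ≤ max B₁ B₂) →
      IsMildSol (fun σ x => F (x, N σ)) a b w θ →
      IsMildSol (fun σ x => χ (x, N σ) • F (x, N σ)) a b w θ := by
    refine fun θ hθB hθ => ⟨hθ.1, fun τ hτ => (hθ.2 τ hτ).trans ?_⟩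
    congr 1
    refine intervalIntegral.integral_congr fun σ hσ => ?_
    rw [uIcc_of_le hτ.1] at hσ
    simp [hone _ (hθB σ ⟨hσ.1, hσ.2.trans hτ.2⟩)]
  obtain ⟨Φ, hΦ, hΦs⟩ :=
    (hcut φ (fun σ hσ => (hB₁ σ hσ).trans (le_max_left _ _)) hφ).toContinuousMap hab
  obtain ⟨Ψ, hΨ, hΨs⟩ :=
    (hcut ψ (fun σ hσ => (hB₂ σ hσ).trans (le_max_right _ _)) hψ).toContinuousMap hab
  have := (existsUnique_cutoff_solution hab hN (hχ.smul hF.continuous) hK hlip w).unique hΦs hΨs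
  intro τ hτ
  rw [← hΦ ⟨τ, hτ⟩, ← hΨ ⟨τ, hτ⟩, this]

/-- A solution exists on `[a, b]` if the solutions of all damped versions of the equation satisfy a
common a priori bound. -/
theorem exists_isMildSol_of_bound (hab : a ≤ b) {F : W × C → W} (hF : ContDiff ℝ 1 F) {N : ℝ → C}
    (hN : BddMeasOn a b N) {w : W} {R : ℝ}
    (hR : ∀ χ : W × C → ℝ, Continuous χ → (∀ v, 0 ≤ χ v ∧ χ v ≤ 1) → ∀ φ : ℝ → W,
      Continuous φ → IsMildSol (fun σ x => χ (x, N σ) • F (x, N σ)) a b w φ →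
      ∀ τ ∈ Icc a b, ‖φ τ‖ ≤ R) :
    ∃ φ, Continuous φ ∧ IsMildSol (fun σ x => F (x, N σ)) a b w φ := by
  obtain ⟨B, hB⟩ := hN.bdd
  obtain ⟨χ, hχ, h01, hone, K, hK, hlip⟩ := exists_cutoff_lipschitz hF (max R B)
  obtain ⟨Φ, hΦ, -⟩ := existsUnique_cutoff_solution hab hN (hχ.smul hF.continuous) hK hlip w
  have hsol := isMildSol_IccExtend (G := fun σ x => χ (x, N σ) • F (x, N σ)) hab hΦ
  refine ⟨IccExtend hab Φ, Φ.continuous.Icc_extend', hsol.1, fun τ hτ => (hsol.2 τ hτ).trans ?_⟩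
  congr 1
  refine intervalIntegral.integral_congr fun σ hσ => ?_
  rw [uIcc_of_le hτ.1] at hσ
  have hσ' : σ ∈ Icc a b := ⟨hσ.1, hσ.2.trans hτ.2⟩
  have hle : ‖(IccExtend hab Φ σ, N σ)‖ ≤ max R B :=
    max_le_max (hR χ hχ h01 _ Φ.continuous.Icc_extend' hsol σ hσ') (hB σ hσ')
  simp [hone _ hle]

end Controlled

/-! ### Strict differentiability of the endpoint in the parameters -/

section Endpoint

/-- A `C¹` map is strictly differentiable uniformly on compact sets. -/
theorem exists_uniform_strict_approx {V W : Type*} [NormedAddCommGroup V] [NormedSpace ℝ V]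
    [NormedAddCommGroup W] [NormedSpace ℝ W] {F : V → W} (hF : ContDiff ℝ 1 F) {K : Set V}
    (hK : IsCompact K) {e : ℝ} (he : 0 < e) :
    ∃ δ, 0 < δ ∧ ∀ c ∈ K, ∀ x ∈ Metric.ball c δ, ∀ y ∈ Metric.ball c δ,
      ‖F x - F y - fderiv ℝ F c (x - y)‖ ≤ e * ‖x - y‖ := by
  have hu := hK.uniformContinuousAt_of_continuousAt (fderiv ℝ F)
    (fun c _ => (hF.continuous_fderiv one_ne_zero).continuousAt) (Metric.dist_mem_uniformity he)
  obtain ⟨δ, hδ, hδu⟩ := Metric.mem_uniformity_dist.1 hu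
  refine ⟨δ, hδ, fun c hc x hx y hy => ?_⟩
  refine Convex.norm_image_sub_le_of_norm_fderiv_le' (𝕜 := ℝ)
    (fun v _ => (hF.differentiable one_ne_zero) v) (fun v hv => ?_) (convex_ball c δ) hy hx
  have : dist (fderiv ℝ F c) (fderiv ℝ F v) < e :=
    hδu (by rw [dist_comm]; exact hv) hc
  rw [dist_comm, dist_eq_norm] at this
  exact this.le

variable {W C P : Type*} [NormedAddCommGroup W] [NormedAddCommGroup C] [NormedSpace ℝ C]
  [NormedAddCommGroup P] [NormedSpace ℝ P] {a b : ℝ}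

theorem bddMeasOn_param (hab : a ≤ b) {N : ℝ → P →L[ℝ] C} (hN : BddMeasOn a b N)
    (q : P × C(Icc a b, W)) : BddMeasOn a b fun σ => (IccExtend hab q.2 σ, N σ q.1) :=
  q.2.continuous.Icc_extend'.continuousOn.bddMeasOn.prodMk (hN.clm_apply_const q.1)

theorem norm_param_le (hab : a ≤ b) {N : ℝ → P →L[ℝ] C} {B : ℝ}
    (hB : ∀ σ ∈ Icc a b, ‖N σ‖ ≤ B) (q : P × C(Icc a b, W)) :
    ∀ σ ∈ Icc a b, ‖(IccExtend hab q.2 σ, N σ q.1)‖ ≤ max 1 B * ‖q‖ := by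
  intro σ hσ
  refine max_le ?_ ?_
  · have h1 : ‖IccExtend hab q.2 σ‖ ≤ ‖q.2‖ := q.2.norm_coe_le_norm _
    calc ‖IccExtend hab q.2 σ‖ ≤ 1 * ‖q‖ := by rw [one_mul]; exact h1.trans (norm_snd_le q)
      _ ≤ max 1 B * ‖q‖ := by gcongr; exact le_max_left _ _
  · refine ((N σ).le_opNorm _).trans ?_
    gcongr
    · exact (hB σ hσ).trans (le_max_right _ _)
    · exact norm_fst_le q

variable [NormedSpace ℝ W]

/-- The linear integral operator `(p, φ) ↦ ∫ₐ^τ A(σ) (φ(σ), N(σ) p) dσ` of Volterra type. -/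
def volterraCLM (hab : a ≤ b) {A : ℝ → W × C →L[ℝ] W} {N : ℝ → P →L[ℝ] C}
    (hA : BddMeasOn a b A) (hN : BddMeasOn a b N) :
    P × C(Icc a b, W) →L[ℝ] C(Icc a b, W) :=
  LinearMap.mkContinuous
    { toFun := fun q => prim a b fun σ => A σ (IccExtend hab q.2 σ, N σ q.1)
      map_add' := by
        intro q q'
        ext1 τ
        have h := hA.clm_apply (bddMeasOn_param hab hN q)
        have h' := hA.clm_apply (bddMeasOn_param hab hN q')
        rw [ContinuousMap.add_apply, prim_apply hab h, prim_apply hab h',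
          prim_apply hab (hA.clm_apply (bddMeasOn_param hab hN (q + q'))),
          ← intervalIntegral.integral_add (h.intervalIntegrable τ.2) (h'.intervalIntegrable τ.2)]
        refine intervalIntegral.integral_congr fun σ _ => ?_
        rw [← map_add]
        congr 1
        simp [IccExtend]
      map_smul' := by
        intro r q
        ext1 τ
        have h := hA.clm_apply (bddMeasOn_param hab hN q)
        rw [ContinuousMap.smul_apply, prim_apply hab h,
          prim_apply hab (hA.clm_apply (bddMeasOn_param hab hN (r • q))),
          RingHom.id_apply, ← intervalIntegral.integral_smul]
        refine intervalIntegral.integral_congr fun σ _ => ?_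
        rw [← map_smul]
        congr 1
        simp [IccExtend] }
    ((b - a) * (hA.bdd.choose * max 1 hN.bdd.choose)) (by
      intro q
      have h0 : 0 ≤ hA.bdd.choose := (norm_nonneg _).trans (hA.bdd.choose_spec a ⟨le_rfl, hab⟩)
      refine (norm_prim_le hab (hA.clm_apply (bddMeasOn_param hab hN q))
        (B := hA.bdd.choose * (max 1 hN.bdd.choose * ‖q‖)) fun σ hσ => ?_).trans
        (le_of_eq (by ring))
      refine ((A σ).le_opNorm _).trans ?_
      gcongr
      · exact hA.bdd.choose_spec σ hσ
      · exact norm_param_le hab hN.bdd.choose_spec q σ hσ)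

theorem volterraCLM_apply (hab : a ≤ b) {A : ℝ → W × C →L[ℝ] W} {N : ℝ → P →L[ℝ] C}
    (hA : BddMeasOn a b A) (hN : BddMeasOn a b N) (q : P × C(Icc a b, W)) :
    volterraCLM hab hA hN q = prim a b fun σ => A σ (IccExtend hab q.2 σ, N σ q.1) := rfl

variable [FiniteDimensional ℝ W] [FiniteDimensional ℝ C]

/-- The nonlinear integral operator `(p, φ) ↦ ∫ₐ^τ F(φ(σ), N(σ) p) dσ` is strictly differentiable,
with the linearized integrand in its derivative. -/
theorem hasStrictFDerivAt_prim (hab : a ≤ b) {F : W × C → W} (hF : ContDiff ℝ 1 F)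
    {N : ℝ → P →L[ℝ] C} (hN : BddMeasOn a b N) (q₀ : P × C(Icc a b, W))
    (hA : BddMeasOn a b fun σ => fderiv ℝ F (IccExtend hab q₀.2 σ, N σ q₀.1)) :
    HasStrictFDerivAt
      (fun q : P × C(Icc a b, W) => prim a b fun σ => F (IccExtend hab q.2 σ, N σ q.1))
      (volterraCLM hab hA hN) q₀ := by
  refine .of_isLittleO (Asymptotics.isLittleO_iff.2 fun e he => ?_)
  obtain ⟨B, hB⟩ := hN.bdd
  obtain ⟨R, hR⟩ := (bddMeasOn_param hab hN q₀).bdd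
  set m := max 1 B with hm
  have hm0 : 0 < m := lt_of_lt_of_le one_pos (le_max_left _ _)
  have hba : 0 < b - a + 1 := by linarith
  obtain ⟨δ, hδ, happ⟩ := exists_uniform_strict_approx hF
    (isCompact_closedBall (0 : W × C) R) (e := e / (m * (b - a + 1))) (by positivity)
  have hnear : ∀ᶠ q : P × C(Icc a b, W) in 𝓝 q₀, ∀ σ ∈ Icc a b,
      (IccExtend hab q.2 σ, N σ q.1) ∈ Metric.ball (IccExtend hab q₀.2 σ, N σ q₀.1) δ := by
    filter_upwards [Metric.ball_mem_nhds q₀ (show 0 < δ / m by positivity)] with q hq σ hσ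
    have h1 := norm_param_le hab hB (q - q₀) σ hσ
    have h2 : (IccExtend hab (q - q₀).2 σ, N σ (q - q₀).1) =
        (IccExtend hab q.2 σ, N σ q.1) - (IccExtend hab q₀.2 σ, N σ q₀.1) := by
      simp [IccExtend]
    rw [h2] at h1
    rw [Metric.mem_ball, dist_eq_norm] at hq ⊢
    refine h1.trans_lt ?_
    rwa [lt_div_iff₀' hm0] at hq
  rw [nhds_prod_eq]
  filter_upwards [hnear.prod_mk hnear] with ⟨q, q'⟩ ⟨hq, hq'⟩
  dsimp only at hq hq' ⊢
  have h1 := bddMeasOn_param hab hN q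
  have h2 := bddMeasOn_param hab hN q'
  have h3 := bddMeasOn_param hab hN (q - q')
  have heq : (prim a b fun σ => F (IccExtend hab q.2 σ, N σ q.1)) -
      (prim a b fun σ => F (IccExtend hab q'.2 σ, N σ q'.1)) - volterraCLM hab hA hN (q - q') =
      prim a b fun σ => F (IccExtend hab q.2 σ, N σ q.1) - F (IccExtend hab q'.2 σ, N σ q'.1) -
        fderiv ℝ F (IccExtend hab q₀.2 σ, N σ q₀.1)
          ((IccExtend hab q.2 σ, N σ q.1) - (IccExtend hab q'.2 σ, N σ q'.1)) := by
    have h5 := h1.comp hF.continuous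
    have h6 := h2.comp hF.continuous
    have h7 := hA.clm_apply h3
    have h8 : ∀ σ, (IccExtend hab (q - q').2 σ, N σ (q - q').1) =
        (IccExtend hab q.2 σ, N σ q.1) - (IccExtend hab q'.2 σ, N σ q'.1) := fun σ => by
      simp [IccExtend]
    simp only [h8] at h7
    ext1 τ
    rw [ContinuousMap.sub_apply, ContinuousMap.sub_apply, volterraCLM_apply, prim_apply hab h5,
      prim_apply hab h6, prim_apply hab ((h5.sub h6).sub h7)]
    simp only [h8]
    rw [prim_apply hab h7, intervalIntegral.integral_sub ((h5.sub h6).intervalIntegrable τ.2)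
      (h7.intervalIntegrable τ.2), intervalIntegral.integral_sub (h5.intervalIntegrable τ.2)
      (h6.intervalIntegrable τ.2)]
  have h8 : ∀ σ, (IccExtend hab q.2 σ, N σ q.1) - (IccExtend hab q'.2 σ, N σ q'.1) =
      (IccExtend hab (q - q').2 σ, N σ (q - q').1) := fun σ => by
    simp [IccExtend]
  have h7 : BddMeasOn a b fun σ => fderiv ℝ F (IccExtend hab q₀.2 σ, N σ q₀.1)
      ((IccExtend hab q.2 σ, N σ q.1) - (IccExtend hab q'.2 σ, N σ q'.1)) := by
    simpa only [h8] using hA.clm_apply h3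
  rw [heq]
  refine (norm_prim_le hab (((h1.comp hF.continuous).sub (h2.comp hF.continuous)).sub h7)
    (B := e / (m * (b - a + 1)) * (m * ‖q - q'‖)) fun σ hσ => ?_).trans ?_
  · refine (happ _ (by simpa using hR σ hσ) _ (hq σ hσ) _ (hq' σ hσ)).trans ?_
    rw [h8]
    gcongr
    exact norm_param_le hab hB (q - q') σ hσ
  · have h9 : (b - a) * (e / (m * (b - a + 1)) * (m * ‖q - q'‖)) =
        (b - a) / (b - a + 1) * (e * ‖q - q'‖) := by
      field_simp
    rw [h9]
    refine mul_le_of_le_one_left (by positivity) ((div_le_one hba).2 (by linarith))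

/-- The endpoint of the solution of a controlled differential equation whose initial value and
control depend linearly on a parameter is strictly differentiable in the parameter, and solutions
exist for all parameters near one for which a solution exists. -/
theorem exists_hasStrictFDerivAt_endpoint [CompleteSpace P] (hab : a ≤ b) {F : W × C → W}
    (hF : ContDiff ℝ 1 F) {N : ℝ → P →L[ℝ] C} (hN : BddMeasOn a b N) (ini : P →L[ℝ] W)
    {p₀ : P} {φ₀ : ℝ → W} (h₀ : IsMildSol (fun σ x => F (x, N σ p₀)) a b (ini p₀) φ₀) :
    ∃ (e : P → W) (e' : P →L[ℝ] W), HasStrictFDerivAt e e' p₀ ∧ ∀ᶠ p in 𝓝 p₀, ∃ φ : ℝ → W,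
      IsMildSol (fun σ x => F (x, N σ p)) a b (ini p) φ ∧ φ b = e p := by
  obtain ⟨Φ₀, -, hΦ₀⟩ := h₀.toContinuousMap hab
  let q₀ : P × C(Icc a b, W) := (p₀, Φ₀)
  have hA : BddMeasOn a b fun σ => fderiv ℝ F (IccExtend hab q₀.2 σ, N σ q₀.1) :=
    (bddMeasOn_param hab hN q₀).comp (hF.continuous_fderiv one_ne_zero)
  let cst : P × C(Icc a b, W) →L[ℝ] C(Icc a b, W) :=
    (ContinuousLinearMap.const ℝ (Icc a b)) ∘L ini ∘L ContinuousLinearMap.fst ℝ P C(Icc a b, W)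
  let Ψ' : P × C(Icc a b, W) →L[ℝ] C(Icc a b, W) :=
    ContinuousLinearMap.snd ℝ P C(Icc a b, W) - cst - volterraCLM hab hA hN
  let Ψ : P × C(Icc a b, W) → C(Icc a b, W) := fun q =>
    q.2 - cst q - prim a b fun σ => F (IccExtend hab q.2 σ, N σ q.1)
  have hΨ : HasStrictFDerivAt Ψ Ψ' q₀ :=
    (hasStrictFDerivAt_snd.sub cst.hasStrictFDerivAt).sub (hasStrictFDerivAt_prim hab hF hN q₀ hA)
  have hΨ0 : ∀ q, Ψ q = 0 ↔ ∀ τ : Icc a b, q.2 τ = ini q.1 +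
      ∫ σ in a..τ, F (IccExtend hab q.2 σ, N σ q.1) := by
    intro q
    have hb := (bddMeasOn_param hab hN q).comp hF.continuous
    rw [ContinuousMap.ext_iff]
    refine forall_congr' fun τ => ?_
    change q.2 τ - ini q.1 - prim a b _ τ = 0 ↔ _
    rw [prim_apply hab hb, sub_sub, sub_eq_zero]
  -- The partial derivative in the trajectory is the identity minus a Volterra operator.
  have hinv : (Ψ' ∘L .inr ℝ P C(Icc a b, W)).IsInvertible := by
    obtain ⟨B, hB0, hB⟩ := hA.exists_pos_bound
    have hbij : Function.Bijective (Ψ' ∘L .inr ℝ P C(Icc a b, W)) := by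
      rw [Function.bijective_iff_existsUnique]
      intro ψ
      have key := existsUnique_fixedPoint_of_volterra hab hB0.le
        (fun φ => ψ + volterraCLM hab hA hN (0, φ)) (fun φ φ' τ => by
          have hφ := hA.clm_apply (bddMeasOn_param hab hN (0, φ))
          have hφ' := hA.clm_apply (bddMeasOn_param hab hN (0, φ'))
          rw [ContinuousMap.add_apply, ContinuousMap.add_apply, add_sub_add_left_eq_sub,
            volterraCLM_apply, volterraCLM_apply, prim_apply hab hφ, prim_apply hab hφ',
            ← intervalIntegral.integral_sub (hφ.intervalIntegrable τ.2)
              (hφ'.intervalIntegrable τ.2), ← intervalIntegral.integral_const_mul]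
          refine intervalIntegral.norm_integral_le_of_norm_le τ.2.1
            (Eventually.of_forall fun σ hσ => ?_)
            ((continuous_const.mul (φ.continuous.Icc_extend'.sub
              φ'.continuous.Icc_extend').norm).intervalIntegrable _ _)
          rw [← map_sub]
          refine (ContinuousLinearMap.le_opNorm _ _).trans ?_
          have hn : ‖((IccExtend hab φ σ, N σ 0) : W × C) - (IccExtend hab φ' σ, N σ 0)‖ =
              ‖IccExtend hab φ σ - IccExtend hab φ' σ‖ := by
            simp [Prod.norm_def]
          rw [hn]
          gcongr
          exact hB σ ⟨hσ.1.le, hσ.2.trans τ.2.2⟩)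
      refine (existsUnique_congr fun φ => ?_).1 key
      have : (Ψ' ∘L .inr ℝ P C(Icc a b, W)) φ = φ - volterraCLM hab hA hN (0, φ) := by
        have hc : cst (0, φ) = 0 := by ext τ; simp [cst]
        simp only [Ψ', ContinuousLinearMap.comp_apply, ContinuousLinearMap.inr_apply,
          sub_apply, ContinuousLinearMap.coe_snd', hc, sub_zero]
      rw [this, sub_eq_iff_eq_add]
      exact eq_comm
    exact ⟨ContinuousLinearEquiv.ofBijective _ (LinearMap.ker_eq_bot.2 hbij.1)
      (LinearMap.range_eq_top.2 hbij.2), by ext; rfl⟩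
  let ev : C(Icc a b, W) →L[ℝ] W := ContinuousMap.evalCLM ℝ (⟨b, hab, le_rfl⟩ : Icc a b)
  refine ⟨fun p => ev (hΨ.implicitFunctionOfProdDomain hinv p), _,
    ev.hasStrictFDerivAt.comp p₀ (hΨ.hasStrictFDerivAt_implicitFunctionOfProdDomain hinv), ?_⟩
  filter_upwards [hΨ.eventually_apply_implicitFunctionOfProdDomain hinv] with p hp
  rw [(hΨ0 q₀).2 hΦ₀, hΨ0] at hp
  refine ⟨_, isMildSol_IccExtend hab hp, ?_⟩
  rw [IccExtend_of_mem hab _ ⟨hab, le_rfl⟩]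
  rfl

end Endpoint

/-! ### Basis functions and coordinate maps -/

/-- A piecewise polynomial is bounded and measurable on `[0, 1]`, whatever its values at the
breakpoints. -/
theorem IsPiecewisePolynomial.bddMeasOn {φ : ℝ → ℝ} (h : IsPiecewisePolynomial φ) :
    BddMeasOn 0 1 φ := by
  obtain ⟨m, b, hb, hb0, hb1, hp⟩ := h
  have hcover : ∀ k : Fin (m + 1), ∀ x ∈ Icc (b 0) (b k),
      x ∈ (⋃ i : Fin m, Ioo (b i.castSucc) (b i.succ)) ∪ ⋃ j, {b j} := by
    intro k
    induction k using Fin.induction with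
    | zero =>
      intro x hx
      exact Or.inr (mem_iUnion.2 ⟨0, le_antisymm hx.2 hx.1⟩)
    | succ i ih =>
      intro x hx
      rcases le_or_gt x (b i.castSucc) with h1 | h1
      · exact ih x ⟨hx.1, h1⟩
      · rcases hx.2.eq_or_lt with h2 | h2
        · exact Or.inr (mem_iUnion.2 ⟨i.succ, h2⟩)
        · exact Or.inl (mem_iUnion.2 ⟨i, h1, h2⟩)
  have hsub : Icc (0 : ℝ) 1 ⊆ (⋃ i : Fin m, Ioo (b i.castSucc) (b i.succ)) ∪ ⋃ j, {b j} := by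
    intro x hx
    rw [← hb0, ← hb1] at hx
    exact hcover _ x hx
  refine ⟨AEStronglyMeasurable.mono_measure (μ := volume.restrict
    ((⋃ i : Fin m, Ioo (b i.castSucc) (b i.succ)) ∪ ⋃ j, {b j})) ?_
    (Measure.restrict_mono hsub le_rfl), ?_⟩
  · refine aestronglyMeasurable_union_iff.2 ⟨aestronglyMeasurable_iUnion_iff.2 fun i => ?_,
      aestronglyMeasurable_iUnion_iff.2 fun j => ?_⟩
    · obtain ⟨p, hp⟩ := hp i
      exact (p.continuousOn.congr hp).aestronglyMeasurable measurableSet_Ioo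
    · rw [Measure.restrict_eq_zero.2 (by simp)]
      exact aestronglyMeasurable_zero_measure _
  · have hbdd : Bornology.IsBounded
        (φ '' ((⋃ i : Fin m, Ioo (b i.castSucc) (b i.succ)) ∪ ⋃ j, {b j})) := by
      rw [image_union, image_iUnion, image_iUnion]
      refine Bornology.IsBounded.union (Bornology.isBounded_iUnion.2 fun i => ?_)
        (Bornology.isBounded_iUnion.2 fun j => ?_)
      · obtain ⟨p, hp⟩ := hp i
        rw [image_congr hp]
        exact ((isCompact_Icc.image_of_continuousOn p.continuousOn).isBounded).subset
          (image_mono Ioo_subset_Icc_self)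
      · simp
    obtain ⟨B, hB⟩ := hbdd.exists_norm_le
    exact ⟨B, fun σ hσ => hB _ (mem_image_of_mem φ (hsub hσ))⟩

/-- The continuous linear map between Euclidean spaces that selects and rearranges coordinates along
a map of index types. -/
def reindexCLM {ι κ : Type*} [Fintype ι] [Fintype κ] (ρ : ι → κ) :
    EuclideanSpace ℝ κ →L[ℝ] EuclideanSpace ℝ ι :=
  LinearMap.toContinuousLinearMap
    { toFun := fun z => WithLp.toLp 2 fun i => z (ρ i)
      map_add' := fun _ _ => rfl
      map_smul' := fun _ _ => rfl }

theorem reindexCLM_apply {ι κ : Type*} [Fintype ι] [Fintype κ] (ρ : ι → κ)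
    (z : EuclideanSpace ℝ κ) : reindexCLM ρ z = WithLp.toLp 2 fun i => z (ρ i) := rfl

section Augmented

variable {nx : ℕ}

/-- `selX` as a continuous linear map. -/
def selXL : Vec (nx + 2) →L[ℝ] Vec nx := reindexCLM (Fin.castAdd 2)

/-- `selY` as a continuous linear map. -/
def selYL : Vec (nx + 2) →L[ℝ] ℝ := EuclideanSpace.proj (Fin.natAdd nx (0 : Fin 2))

/-- `selT` as a continuous linear map. -/
def selTL : Vec (nx + 2) →L[ℝ] ℝ := EuclideanSpace.proj (Fin.natAdd nx (1 : Fin 2))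

theorem contDiff_selX : ContDiff ℝ 1 (selX (nx := nx)) := selXL.contDiff

theorem contDiff_selY : ContDiff ℝ 1 (selY (nx := nx)) := selYL.contDiff

theorem contDiff_selT : ContDiff ℝ 1 (selT (nx := nx)) := selTL.contDiff

@[simp] theorem selX_mkAug (x : Vec nx) (y t : ℝ) : selX (mkAug x y t) = x := by
  ext i; simp [selX, mkAug]

@[simp] theorem selY_mkAug (x : Vec nx) (y t : ℝ) : selY (mkAug x y t) = y := by
  simp [selY, mkAug]

@[simp] theorem selT_mkAug (x : Vec nx) (y t : ℝ) : selT (mkAug x y t) = t := by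
  simp [selT, mkAug]

theorem norm_aug_le (w : Vec (nx + 2)) : ‖w‖ ≤ ‖selX w‖ + |selY w| + |selT w| := by
  have h : ‖w‖ ^ 2 = ‖selX w‖ ^ 2 + |selY w| ^ 2 + |selT w| ^ 2 := by
    rw [EuclideanSpace.norm_sq_eq, EuclideanSpace.norm_sq_eq, Fin.sum_univ_add, Fin.sum_univ_two]
    simp [selX, selY, selT, add_assoc]
  refine le_of_sq_le_sq ?_ (by positivity)
  rw [h]
  nlinarith [norm_nonneg (selX w), abs_nonneg (selY w), abs_nonneg (selT w),
    mul_nonneg (norm_nonneg (selX w)) (abs_nonneg (selY w)),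
    mul_nonneg (norm_nonneg (selX w)) (abs_nonneg (selT w)),
    mul_nonneg (abs_nonneg (selY w)) (abs_nonneg (selT w))]

theorem contDiff_mkAug {V : Type*} [NormedAddCommGroup V] [NormedSpace ℝ V] {x : V → Vec nx}
    {y t : V → ℝ} (hx : ContDiff ℝ 1 x) (hy : ContDiff ℝ 1 y) (ht : ContDiff ℝ 1 t) :
    ContDiff ℝ 1 fun v => mkAug (x v) (y v) (t v) := by
  refine contDiff_euclidean.2 fun i => ?_
  induction i using Fin.addCases with
  | left i => simpa [mkAug] using contDiff_euclidean.1 hx i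
  | right i => fin_cases i <;> simpa [mkAug]

end Augmented

/-- Grönwall's inequality in integrated form. -/
theorem le_gronwallBound_of_le_integral {a b A K β : ℝ} (hA : 0 ≤ A) (hK : 0 ≤ K) (hβ : 0 ≤ β)
    {u : ℝ → ℝ} (hu : Continuous u) (hu0 : ∀ τ, 0 ≤ u τ)
    (h : ∀ τ ∈ Icc a b, u τ ≤ A + ∫ σ in a..τ, (K * u σ + β)) :
    ∀ τ ∈ Icc a b, u τ ≤ gronwallBound A K β (τ - a) := by
  have hc : Continuous fun σ => K * u σ + β := by fun_prop
  have hderiv : ∀ τ, HasDerivAt (fun τ => A + ∫ σ in a..τ, (K * u σ + β)) (K * u τ + β) τ :=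
    fun τ => (intervalIntegral.integral_hasDerivAt_right (hc.intervalIntegrable _ _)
      hc.stronglyMeasurable.stronglyMeasurableAtFilter hc.continuousAt).const_add A
  have hv := norm_le_gronwallBound_of_norm_deriv_right_le (a := a) (b := b) (δ := A) (K := K)
    (ε := β) (f := fun τ => A + ∫ σ in a..τ, (K * u σ + β)) (f' := fun τ => K * u τ + β)
    (fun τ _ => (hderiv τ).continuousAt.continuousWithinAt)
    (fun τ _ => (hderiv τ).hasDerivWithinAt) (by simp [abs_of_nonneg hA]) (fun τ hτ => by
      have h1 := h τ ⟨hτ.1, hτ.2.le⟩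
      rw [Real.norm_eq_abs, Real.norm_eq_abs, abs_of_nonneg (by have := hu0 τ; positivity)]
      gcongr
      exact h1.trans (le_abs_self _))
  exact fun τ hτ => (h τ hτ).trans ((le_abs_self _).trans (hv τ hτ))

namespace Discretization

variable {nx nu : ℕ} {O : OptimalControlProblem nx nu} (D : Discretization O)

/-! ### The augmented dynamics -/

theorem contDiff_Λ : ContDiff ℝ 1 D.Λ := by
  refine ContDiff.add (ContDiff.sum fun i _ => ?_) (ContDiff.sum fun j _ => ?_)
  · exact (D.penalty_q i).1.comp (contDiff_euclidean.1 O.contDiff_g i)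
  · exact (D.penalty_p j).1.comp (contDiff_euclidean.1 O.contDiff_h j)

theorem contDiff_F : ContDiff ℝ 1 fun v : Vec (nx + 2) × (Vec nu × ℝ) => D.F v.1 v.2 := by
  have h : ContDiff ℝ 1 fun v : Vec (nx + 2) × (Vec nu × ℝ) => (selT v.1, selX v.1, v.2.1) :=
    (contDiff_selT.comp contDiff_fst).prodMk
      ((contDiff_selX.comp contDiff_fst).prodMk (contDiff_fst.comp contDiff_snd))
  exact (contDiff_snd.comp contDiff_snd).smul
    (contDiff_mkAug (O.contDiff_f.comp h) (D.contDiff_Λ.comp h) contDiff_const)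

/-- The value `ν̃(σ)` of the control input as a continuous linear function of the decision vector. -/
def νL (σ : ℝ) : D.Z →L[ℝ] Vec nu × ℝ :=
  ∑ k, D.Γu k σ • (ContinuousLinearMap.inl ℝ (Vec nu) ℝ ∘L
      reindexCLM (κ := D.Idx) fun i => Sum.inr (Sum.inl (k, i))) +
    ∑ k, D.Γs k σ • (ContinuousLinearMap.inr ℝ (Vec nu) ℝ ∘L
      EuclideanSpace.proj (ι := D.Idx) (Sum.inr (Sum.inr k)))

theorem νL_apply (σ : ℝ) (z : D.Z) : D.νL σ z = D.ν (ctrl z) (dil z) σ := by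
  ext i
  · simp [νL, ν, ctrl, reindexCLM_apply, sum_apply, Prod.fst_sum]
  · simp [νL, ν, dil, reindexCLM_apply, sum_apply, Prod.snd_sum]

theorem bddMeasOn_νL : BddMeasOn 0 1 D.νL :=
  (BddMeasOn.sum _ fun k _ => (D.piecewise_Γu k).bddMeasOn.smul_const _).add
    (BddMeasOn.sum _ fun k _ => (D.piecewise_Γs k).bddMeasOn.smul_const _)

theorem node_mem_Icc (k : Fin (D.M + 1)) : D.node k ∈ Icc (0 : ℝ) 1 := by
  rw [← D.node_zero, ← D.node_last]
  exact ⟨D.node_strictMono.monotone (Fin.zero_le k), D.node_strictMono.monotone (Fin.le_last k)⟩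

theorem node_lt (k : Fin D.M) : D.node k.castSucc < D.node k.succ :=
  D.node_strictMono k.castSucc_lt_succ

theorem bddMeasOn_νL_shooting (k : Fin D.M) :
    BddMeasOn (D.node k.castSucc) (D.node k.succ) D.νL :=
  D.bddMeasOn_νL.mono (D.node_mem_Icc _).1 (D.node_mem_Icc _).2

/-- `φ` solves the augmented system with the control input of `z` on `[a, b]`. -/
abbrev IsSol (z : D.Z) (a b : ℝ) (w : Vec (nx + 2)) (φ : ℝ → Vec (nx + 2)) : Prop :=
  IsMildSol (fun σ x => D.F x (D.νL σ z)) a b w φ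

/-- Where the augmented system has a solution, the defect measures the jump between the end of that
solution and the next node. -/
theorem Fk_eq_of_isSol (k : Fin D.M) (i : Fin (nx + 2)) {z : D.Z} {φ : ℝ → Vec (nx + 2)}
    (h : D.IsSol z (D.node k.castSucc) (D.node k.succ) (xt z k.castSucc) φ) :
    D.Fk k i z = (xt z k.succ - φ (D.node k.succ)) i := by
  have hab := (D.node_lt k).le
  have hN := (D.bddMeasOn_νL_shooting k).clm_apply_const z
  have htraj : ∃ φ, D.IsTrajectory (ctrl z) (dil z) (D.node k.castSucc) (D.node k.succ)
      (xt z k.castSucc) φ := by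
    refine ⟨φ, h.1, ?_, fun τ hτ => ?_⟩
    · simp only [← νL_apply]
      exact (bddMeasOn_comp_control D.contDiff_F.continuous hN h.1).intervalIntegrable
        (right_mem_Icc.2 hab)
    · simp only [← νL_apply]
      exact h.2 τ hτ
  set ψ := D.trajectory (ctrl z) (dil z) (D.node k.castSucc) (D.node k.succ) (xt z k.castSucc)
    with hψ
  have hψt : D.IsTrajectory (ctrl z) (dil z) (D.node k.castSucc) (D.node k.succ)
      (xt z k.castSucc) ψ := by
    rw [hψ, trajectory, dif_pos htraj]
    exact htraj.choose_spec
  have hψs : D.IsSol z (D.node k.castSucc) (D.node k.succ) (xt z k.castSucc) ψ := by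
    refine ⟨hψt.1, fun τ hτ => ?_⟩
    simp only [νL_apply]
    exact hψt.2.2 τ hτ
  have heq := IsMildSol.eqOn hab D.contDiff_F hN h hψs (right_mem_Icc.2 hab)
  have hend := hψt.2.2 _ (right_mem_Icc.2 hab)
  rw [Fk, defect, ← hψ, heq, hend, sub_sub]

/-- The a priori bound behind global existence: along a damped version of the augmented system with
nonnegative dilation factor, time only increases, so that the linear growth of `f` bounds `x`, and
then `y`. -/
theorem exists_bound_of_damped (z : D.Z) (hz : dil z ∈ D.SS.set) {a b : ℝ} (ha : 0 ≤ a)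
    (hab : a ≤ b) (hb : b ≤ 1) (w : Vec (nx + 2)) (hw : O.ti ≤ selT w) :
    ∃ R, ∀ χ : Vec (nx + 2) × (Vec nu × ℝ) → ℝ, Continuous χ → (∀ v, 0 ≤ χ v ∧ χ v ≤ 1) →
      ∀ φ : ℝ → Vec (nx + 2), Continuous φ →
      IsMildSol (fun σ x => χ (x, D.νL σ z) • D.F x (D.νL σ z)) a b w φ →
      (∀ τ ∈ Icc a b, O.ti ≤ selT (φ τ)) ∧ ∀ τ ∈ Icc a b, ‖φ τ‖ ≤ R := by
  have hN : BddMeasOn a b fun σ => D.νL σ z := (D.bddMeasOn_νL.mono ha hb).clm_apply_const z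
  obtain ⟨B, hB0, hB⟩ := hN.exists_pos_bound
  have hs : ∀ σ ∈ Icc a b, |(D.νL σ z).2| ≤ B := fun σ hσ => (norm_snd_le _).trans (hB σ hσ)
  set tf := selT w + (b - a) * B + 1 with htf
  have hba : 0 ≤ b - a := sub_nonneg.2 hab
  have htf' : O.ti < tf := by nlinarith
  obtain ⟨α, β, hα, hβ, hgrow⟩ := O.growth _ (isCompact_closedBall (0 : Vec nu) B) tf htf'
  set Rx := gronwallBound ‖selX w‖ (B * α) (B * β) (b - a) with hRx
  obtain ⟨m, hm⟩ := (isCompact_Icc.prod ((isCompact_closedBall (0 : Vec nx) Rx).prod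
    (isCompact_closedBall (0 : Vec nu) B))).exists_bound_of_continuousOn
      (f := D.Λ) D.contDiff_Λ.continuous.continuousOn
  refine ⟨Rx + (|selY w| + B * m * (b - a)) + (|O.ti| + |tf|), fun χ hχ h01 φ hφc hφ => ?_⟩
  have hint : BddMeasOn a b fun σ => χ (φ σ, D.νL σ z) • D.F (φ σ) (D.νL σ z) :=
    bddMeasOn_comp_control (F := fun v => χ v • D.F v.1 v.2) (hχ.smul D.contDiff_F.continuous) hN
      hφc.continuousOn
  have hproj : ∀ {V : Type} [NormedAddCommGroup V] [NormedSpace ℝ V] [CompleteSpace V]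
      (ℓ : Vec (nx + 2) →L[ℝ] V), ∀ τ ∈ Icc a b,
      ℓ (φ τ) = ℓ w + ∫ σ in a..τ, ℓ (χ (φ σ, D.νL σ z) • D.F (φ σ) (D.νL σ z)) := by
    intro V _ _ _ ℓ τ hτ
    rw [ℓ.intervalIntegral_comp_comm (hint.intervalIntegrable hτ), ← map_add]
    exact congrArg ℓ (hφ.2 τ hτ)
  set ξ : ℝ → ℝ := fun σ => χ (φ σ, D.νL σ z) with hξ
  have hξs : ∀ σ ∈ Icc a b, |ξ σ * (D.νL σ z).2| ≤ B := by
    intro σ hσ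
    rw [abs_mul, abs_of_nonneg (h01 _).1]
    exact (mul_le_of_le_one_left (abs_nonneg _) (h01 _).2).trans (hs σ hσ)
  have hFT : ∀ σ, selTL (ξ σ • D.F (φ σ) (D.νL σ z)) = ξ σ * (D.νL σ z).2 := by
    intro σ
    have : selTL (D.F (φ σ) (D.νL σ z)) = (D.νL σ z).2 * 1 := by
      rw [F, map_smul, smul_eq_mul]
      exact congrArg _ (selT_mkAug _ _ _)
    rw [map_smul, this, mul_one, smul_eq_mul]
  have hFY : ∀ σ, selYL (ξ σ • D.F (φ σ) (D.νL σ z)) =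
      (ξ σ * (D.νL σ z).2) * D.Λ (selT (φ σ), selX (φ σ), (D.νL σ z).1) := by
    intro σ
    have : selYL (D.F (φ σ) (D.νL σ z)) =
        (D.νL σ z).2 * D.Λ (selT (φ σ), selX (φ σ), (D.νL σ z).1) := by
      rw [F, map_smul, smul_eq_mul]
      exact congrArg _ (selY_mkAug _ _ _)
    rw [map_smul, this, smul_eq_mul, mul_assoc]
  have hFX : ∀ σ, selXL (ξ σ • D.F (φ σ) (D.νL σ z)) =
      (ξ σ * (D.νL σ z).2) • O.f (selT (φ σ), selX (φ σ), (D.νL σ z).1) := by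
    intro σ
    have : selXL (D.F (φ σ) (D.νL σ z)) =
        (D.νL σ z).2 • O.f (selT (φ σ), selX (φ σ), (D.νL σ z).1) := by
      rw [F, map_smul]
      exact congrArg _ (selX_mkAug _ _ _)
    rw [map_smul, this, mul_smul]
  have hnorm : ∀ g : ℝ → ℝ, ∀ c, (∀ σ ∈ Icc a b, |g σ| ≤ c) → ∀ τ ∈ Icc a b,
      |∫ σ in a..τ, g σ| ≤ (b - a) * c := by
    intro g c hg τ hτ
    have hc : 0 ≤ c := (abs_nonneg _).trans (hg τ hτ)
    rw [← Real.norm_eq_abs]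
    refine (intervalIntegral.norm_integral_le_of_norm_le_const (C := c) fun σ hσ => ?_).trans ?_
    · rw [uIoc_of_le hτ.1] at hσ
      exact hg σ ⟨hσ.1.le, hσ.2.trans hτ.2⟩
    · rw [abs_of_nonneg (sub_nonneg.2 hτ.1), mul_comm]
      gcongr
      exact hτ.2
  -- Time is nondecreasing because the dilation factor is positive almost everywhere.
  have hT : ∀ τ ∈ Icc a b, selT (φ τ) ∈ Icc O.ti tf := by
    intro τ hτ
    have h1 : selT (φ τ) = selT w + ∫ σ in a..τ, ξ σ * (D.νL σ z).2 := by
      rw [show selT (φ τ) = selTL (φ τ) from rfl, hproj selTL τ hτ]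
      exact congrArg _ (intervalIntegral.integral_congr fun σ _ => hFT σ)
    have h2 : 0 ≤ ∫ σ in a..τ, ξ σ * (D.νL σ z).2 := by
      refine intervalIntegral.integral_nonneg_of_ae_restrict hτ.1 ?_
      have hpos := ae_restrict_of_ae_restrict_of_subset
        (Icc_subset_Icc ha (hτ.2.trans hb)) (D.dilation_pos _ hz)
      filter_upwards [hpos] with σ hσ
      rw [νL_apply]
      exact mul_nonneg (h01 _).1 hσ.le
    have h3 := (abs_le.1 (hnorm _ _ hξs τ hτ)).2
    constructor <;> rw [h1] <;> linarith
  have hu : ∀ σ ∈ Icc a b, (D.νL σ z).1 ∈ Metric.closedBall (0 : Vec nu) B := fun σ hσ => by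
    rw [mem_closedBall_zero_iff]
    exact (norm_fst_le _).trans (hB σ hσ)
  have hXc : Continuous fun τ => ‖selX (φ τ)‖ := (contDiff_selX.continuous.comp hφc).norm
  have hX : ∀ τ ∈ Icc a b, ‖selX (φ τ)‖ ≤ Rx := by
    intro τ hτ
    refine (le_gronwallBound_of_le_integral (a := a) (b := b) (norm_nonneg (selX w))
      (by positivity : 0 ≤ B * α) (by positivity : 0 ≤ B * β) hXc
      (fun _ => norm_nonneg _) (fun τ hτ => ?_) τ hτ).trans ?_
    · have h1 : selX (φ τ) = selX w + ∫ σ in a..τ, (ξ σ * (D.νL σ z).2) •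
          O.f (selT (φ σ), selX (φ σ), (D.νL σ z).1) := by
        rw [show selX (φ τ) = selXL (φ τ) from rfl, hproj selXL τ hτ]
        exact congrArg _ (intervalIntegral.integral_congr fun σ _ => hFX σ)
      rw [h1]
      refine (norm_add_le _ _).trans (add_le_add_right ?_ _)
      refine intervalIntegral.norm_integral_le_of_norm_le hτ.1
        (Eventually.of_forall fun σ hσ => ?_) (Continuous.intervalIntegrable (by fun_prop) _ _)
      have hσ' : σ ∈ Icc a b := ⟨hσ.1.le, hσ.2.trans hτ.2⟩
      rw [norm_smul, Real.norm_eq_abs]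
      calc |ξ σ * (D.νL σ z).2| * ‖O.f (selT (φ σ), selX (φ σ), (D.νL σ z).1)‖
          ≤ B * (α * ‖selX (φ σ)‖ + β) := by
            gcongr
            · exact hξs σ hσ'
            · exact hgrow _ (hT σ hσ') _ _ (hu σ hσ')
        _ = B * α * ‖selX (φ σ)‖ + B * β := by ring
    · exact gronwallBound_mono (norm_nonneg _) (by positivity) (by positivity)
        (by linarith [hτ.2] : τ - a ≤ b - a)
  refine ⟨fun τ hτ => (hT τ hτ).1, fun τ hτ => (norm_aug_le _).trans ?_⟩
  have hY : |selY (φ τ)| ≤ |selY w| + B * m * (b - a) := by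
    have h1 : selY (φ τ) = selY w + ∫ σ in a..τ, (ξ σ * (D.νL σ z).2) *
        D.Λ (selT (φ σ), selX (φ σ), (D.νL σ z).1) := by
      rw [show selY (φ τ) = selYL (φ τ) from rfl, hproj selYL τ hτ]
      exact congrArg _ (intervalIntegral.integral_congr fun σ _ => hFY σ)
    rw [h1]
    refine (abs_add_le _ _).trans (add_le_add_right ((hnorm _ (B * m) (fun σ hσ => ?_) τ hτ).trans
      (le_of_eq (by ring))) _)
    rw [abs_mul]
    gcongr
    · exact hξs σ hσ
    · exact hm _ ⟨hT σ hσ, by simpa using hX σ hσ, hu σ hσ⟩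
  have hTa : |selT (φ τ)| ≤ |O.ti| + |tf| := by
    have := hT τ hτ
    rcases abs_cases (selT (φ τ)) with h | h <;> rcases abs_cases O.ti with h' | h' <;>
      rcases abs_cases tf with h'' | h'' <;> linarith [this.1, this.2]
  have := hX τ hτ
  linarith

/-- The augmented system has a solution from every augmented state whose time is not before the
initial time, and time does not decrease below the initial time. -/
theorem exists_isSol (z : D.Z) (hz : dil z ∈ D.SS.set) {a b : ℝ} (ha : 0 ≤ a)
    (hab : a ≤ b) (hb : b ≤ 1) (w : Vec (nx + 2)) (hw : O.ti ≤ selT w) :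
    ∃ φ, D.IsSol z a b w φ ∧ O.ti ≤ selT (φ b) := by
  obtain ⟨R, hR⟩ := D.exists_bound_of_damped z hz ha hab hb w hw
  have hN : BddMeasOn a b fun σ => D.νL σ z := (D.bddMeasOn_νL.mono ha hb).clm_apply_const z
  obtain ⟨φ, hφc, hφ⟩ := exists_isMildSol_of_bound hab D.contDiff_F hN (w := w) (R := R)
    fun χ hχ h01 φ hφc hφ => (hR χ hχ h01 φ hφc hφ).2
  refine ⟨φ, hφ, (hR (fun _ => 1) continuous_const (fun _ => ⟨zero_le_one, le_rfl⟩) φ hφc ?_).1 b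
    (right_mem_Icc.2 hab)⟩
  simpa only [one_smul] using hφ

end Discretization

namespace Discretization

variable {nx nu : ℕ} {O : OptimalControlProblem nx nu} (D : Discretization O)

/-! ### Smoothness of the constraints at a feasible point -/

/-- At a feasible point the trajectories exist on all shooting intervals: the defects vanish, so
each interval starts where the previous trajectory ends, at a time not before the initial time. -/
theorem exists_isSol_of_feasible {z : D.Z} (hz : z ∈ D.feasible) (k : Fin D.M) :
    ∃ φ, D.IsSol z (D.node k.castSucc) (D.node k.succ) (xt z k.castSucc) φ := by
  obtain ⟨hF, ⟨-, -, hS⟩, -, hQ⟩ := hz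
  have hex : ∀ k : Fin D.M, O.ti ≤ selT (xt z k.castSucc) → ∃ φ,
      D.IsSol z (D.node k.castSucc) (D.node k.succ) (xt z k.castSucc) φ ∧
      O.ti ≤ selT (φ (D.node k.succ)) := fun k hk =>
    D.exists_isSol z hS (D.node_mem_Icc _).1 (D.node_lt k).le (D.node_mem_Icc _).2 _ hk
  have hti : ∀ k : Fin (D.M + 1), O.ti ≤ selT (xt z k) := by
    intro k
    induction k using Fin.induction with
    | zero =>
      have := hQ (Fin.last _)
      simp only [Qt, Fin.snoc_last] at this
      linarith
    | succ k ih =>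
      obtain ⟨φ, hφ, hT⟩ := hex k ih
      have : xt z k.succ = φ (D.node k.succ) := by
        ext i
        have := hF k i
        rw [D.Fk_eq_of_isSol k i hφ] at this
        exact sub_eq_zero.1 this
      rwa [this]
  obtain ⟨φ, hφ, -⟩ := hex k (hti _)
  exact ⟨φ, hφ⟩

/-- `xt` as a continuous linear map. -/
def xtL (k : Fin (D.M + 1)) : D.Z →L[ℝ] Vec (nx + 2) :=
  reindexCLM (κ := D.Idx) fun i => Sum.inl (k, i)

theorem contDiff_xt (k : Fin (D.M + 1)) : ContDiff ℝ 1 fun z : D.Z => xt z k := (D.xtL k).contDiff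

theorem contDiff_ctrl : ContDiff ℝ 1 fun z : D.Z => ctrl z :=
  (reindexCLM (κ := D.Idx) fun i => Sum.inr (Sum.inl i)).contDiff

theorem contDiff_dil : ContDiff ℝ 1 fun z : D.Z => dil z :=
  (reindexCLM (κ := D.Idx) fun i => Sum.inr (Sum.inr i)).contDiff

/-- At a feasible point the trajectory on each shooting interval exists, so that near it the defect
is the next node minus the endpoint map of the augmented system. -/
theorem hasStrictFDerivAt_Fk {z : D.Z} (hz : z ∈ D.feasible) (k : Fin D.M) (i : Fin (nx + 2)) :
    HasStrictFDerivAt (D.Fk k i) (fderiv ℝ (D.Fk k i) z) z := by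
  obtain ⟨φ, hφ⟩ := D.exists_isSol_of_feasible hz k
  obtain ⟨e, e', he, hev⟩ := exists_hasStrictFDerivAt_endpoint (D.node_lt k).le D.contDiff_F
    (D.bddMeasOn_νL_shooting k) (D.xtL k.castSucc) hφ
  have h : HasStrictFDerivAt (fun z => (xt z k.succ - e z) i)
      (EuclideanSpace.proj (𝕜 := ℝ) i ∘L (D.xtL k.succ - e')) z :=
    (EuclideanSpace.proj (𝕜 := ℝ) i : Vec (nx + 2) →L[ℝ] ℝ).hasStrictFDerivAt.comp z
      ((D.xtL k.succ).hasStrictFDerivAt.sub he)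
  have h' := h.congr_of_eventuallyEq (f₁ := D.Fk k i) (by
    filter_upwards [hev] with y hy
    obtain ⟨ψ, hψ, hψe⟩ := hy
    rw [D.Fk_eq_of_isSol k i hψ, hψe])
  rwa [h'.hasFDerivAt.fderiv]

theorem contDiff_boundary {t : D.Z → ℝ} (ht : ContDiff ℝ 1 t) : ContDiff ℝ 1 fun z : D.Z =>
    (t z, selX (xt z 0), selT (xt z (Fin.last D.M)), selX (xt z (Fin.last D.M))) :=
  ht.prodMk ((contDiff_selX.comp (D.contDiff_xt 0)).prodMk
    ((contDiff_selT.comp (D.contDiff_xt _)).prodMk (contDiff_selX.comp (D.contDiff_xt _))))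

theorem contDiff_Pt (i : Fin O.nP) : ContDiff ℝ 1 (D.Pt i) :=
  (contDiff_euclidean.1 O.contDiff_P i).comp
    (D.contDiff_boundary (contDiff_selT.comp (D.contDiff_xt 0)))

theorem contDiff_Qt (i : Fin (O.nQ + 1)) : ContDiff ℝ 1 (D.Qt i) := by
  induction i using Fin.lastCases with
  | last =>
    have : D.Qt (Fin.last _) = fun z => selT (xt z 0) - O.ti := by
      ext z; simp [Qt]
    rw [this]
    exact (contDiff_selT.comp (D.contDiff_xt 0)).sub contDiff_const
  | cast j =>
    have : D.Qt j.castSucc = fun z => O.Q (O.ti, selX (xt z 0), selT (xt z (Fin.last D.M)),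
        selX (xt z (Fin.last D.M))) j := by
      ext z; simp [Qt]
    rw [this]
    exact (contDiff_euclidean.1 O.contDiff_Q j).comp (D.contDiff_boundary contDiff_const)

theorem contDiff_obj : ContDiff ℝ 1 D.obj :=
  O.contDiff_L.comp ((contDiff_selT.comp (D.contDiff_xt _)).prodMk
    (contDiff_selX.comp (D.contDiff_xt _)))

theorem hasStrictFDerivAt_eqC {z : D.Z} (hz : z ∈ D.feasible) (i : D.EqIdx) :
    HasStrictFDerivAt (D.eqC i) (fderiv ℝ (D.eqC i) z) z := by
  rcases i with ki | i | j | j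
  · exact D.hasStrictFDerivAt_Fk hz ki.1 ki.2
  · exact (D.contDiff_Qt i).contDiffAt.hasStrictFDerivAt one_ne_zero
  · exact ContDiffAt.hasStrictFDerivAt (n := 1) (ContDiff.contDiffAt
      ((contDiff_const.inner ℝ D.contDiff_ctrl).add contDiff_const)) one_ne_zero
  · exact ContDiffAt.hasStrictFDerivAt (n := 1) (ContDiff.contDiffAt
      ((contDiff_const.inner ℝ D.contDiff_dil).add contDiff_const)) one_ne_zero

theorem contDiff_ineqC (i : D.IneqIdx) : ContDiff ℝ 1 (D.ineqC i) := by
  rcases i with i | k | i | i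
  · exact D.contDiff_Pt i
  · exact (contDiff_selY.comp ((D.contDiff_xt _).sub (D.contDiff_xt _))).sub contDiff_const
  · exact (D.US.contDiff_Ω i).comp D.contDiff_ctrl
  · exact (D.SS.contDiff_Ω i).comp D.contDiff_dil

/-! ### The discretized problem as a penalized nonlinear program -/

/-- The equality constraints that are penalized: the defects and the boundary conditions. -/
def IsSoftEq : D.EqIdx → Prop
  | .inl _ => True
  | .inr (.inl _) => True
  | .inr (.inr _) => False

/-- The inequality constraints that are penalized: the boundary conditions. -/
def IsSoftIneq : D.IneqIdx → Prop
  | .inl _ => True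
  | .inr _ => False

instance : DecidablePred D.IsSoftEq
  | .inl _ => isTrue trivial
  | .inr (.inl _) => isTrue trivial
  | .inr (.inr _) => isFalse id

instance : DecidablePred D.IsSoftIneq
  | .inl _ => isTrue trivial
  | .inr _ => isFalse id

theorem feasible_eq : D.feasible = {z | (∀ i, D.eqC i z = 0) ∧ ∀ j, D.ineqC j z ≤ 0} := by
  ext z
  simp only [feasible, Zset, ConvexSystem.set, mem_ofPred_eq, Sum.forall, Prod.forall, eqC, ineqC]
  tauto

theorem Zset_eq : D.Zset = hardSet D.eqC D.ineqC D.IsSoftEq D.IsSoftIneq := by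
  ext z
  simp only [hardSet, Zset, ConvexSystem.set, mem_ofPred_eq, Sum.forall, eqC, ineqC, IsSoftEq,
    IsSoftIneq, not_true_eq_false, not_false_eq_true, false_imp_iff, true_imp_iff, implies_true,
    true_and]
  tauto

theorem penalty_eq : D.penalty = softPenalty D.eqC D.ineqC D.IsSoftEq D.IsSoftIneq := by
  ext z
  have h1 : ∀ i, D.IsSoftEq (.inl i) := fun _ => trivial
  have h2 : ∀ i, D.IsSoftEq (.inr (.inl i)) := fun _ => trivial
  have h3 : ∀ i, ¬ D.IsSoftEq (.inr (.inr i)) := fun _ => id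
  have h4 : ∀ j, D.IsSoftIneq (.inl j) := fun _ => trivial
  have h5 : ∀ j, ¬ D.IsSoftIneq (.inr j) := fun _ => id
  simp only [penalty, softPenalty, Fintype.sum_sum_type, Fintype.sum_prod_type, if_pos (h1 _),
    if_pos (h2 _), if_neg (h3 _), if_pos (h4 _), if_neg (h5 _), eqC, ineqC,
    Finset.sum_const_zero, add_zero]
  ring

theorem Θ_eq (γ : ℝ) : D.Θ γ = fun z =>
    ((D.obj z + γ * softPenalty D.eqC D.ineqC D.IsSoftEq D.IsSoftIneq z : ℝ) : EReal) +
      indicatorFun (hardSet D.eqC D.ineqC D.IsSoftEq D.IsSoftIneq) z := by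
  rw [← penalty_eq, ← Zset_eq]
  rfl

end Discretization

end CTOpt

end

theorem theorem3 {nx nu : ℕ} (O : CTOpt.OptimalControlProblem nx nu)
    (D : CTOpt.Discretization O) (zstar : D.Z)
    (hmin : D.IsLocalMinimizer zstar) (hlicq : D.LICQ zstar) :
    (∃ γbar : ℝ, 0 < γbar ∧ ∀ γ : ℝ, γbar ≤ γ → IsLocalMin (D.Θ γ) zstar) ∧
    (∃ γtilde σtilde : ℝ, 0 < γtilde ∧ 0 < σtilde ∧
      ∀ γ : ℝ, γtilde ≤ γ → ∀ z : D.Z, CTOpt.IsStationary (D.Θ γ) z →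
        ‖z - zstar‖ ≤ σtilde → z ∈ D.feasible) := by
  obtain ⟨hfeas, hloc⟩ := hmin
  have hc := D.hasStrictFDerivAt_eqC hfeas
  have hg := fun j => (D.contDiff_ineqC j).contDiffAt (x := zstar) |>.hasStrictFDerivAt one_ne_zero
  have hobj := D.contDiff_obj.contDiffAt (x := zstar) |>.hasStrictFDerivAt one_ne_zero
  have hfeas' := hfeas
  rw [D.feasible_eq] at hfeas' hloc
  simp only [D.Θ_eq, D.feasible_eq]
  exact ⟨CTOpt.isLocalMin_penalized_of_linearIndependent hc hg hlicq hfeas'.1 hfeas'.2 hobj hloc,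
    CTOpt.stationary_penalized_feasible_of_linearIndependent hc hg hlicq hfeas'.1 hfeas'.2 hobj
      D.contDiff_obj.continuous⟩
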